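/- Let $q\in\mathbb C\setminus\{0\}$ not be a root of unity, fix a square root $q^{1/2}$ of $q$ and put $q^{n/2}=(q^{1/2})^n$ for $n\in\mathbb Z$. Write $c=q^{1/2}+q^{-1/2}$ and $[n]_q=(q^n-q^{-n})/(q-q^{-1})$. For $A_3\in\mathbb C$ let $\mathrm{AW}_q(0,0,A_3)$ be the complex associative unital algebra generated by $I_1,I_2,I_3$ with relations $$q^{1/2}I_1I_2-q^{-1/2}I_2I_1=I_3+A_3,\quad q^{1/2}I_2I_3-q^{-1/2}I_3I_2=I_1,\quad q^{1/2}I_3I_1-q^{-1/2}I_1I_3=I_2 .$$ Let $N\ge 0$ be an integer, and let $v_0,\dots,v_N$ be the standard basis of $\mathbb C^{N+1}$. *Non-classical representations.* Let $P$ be the set of pairs $(\varepsilon,a)\in\mathbb C^2$ with $\varepsilon=\pm1$ and $$a^2=-q[N+1]_q^2-\varepsilon q\,c\,\frac{(q^{(N+1)/2}-q^{-(N+1)/2})^2}{q-q^{-1}}A_3 .$$ Put $F_j=\frac{q^{N+1-j}(1+q^j)(1+q^{-2N-2+j})}{q-q^{-1}}+\varepsilon cA_3$. For $(\varepsilon,a)\in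 P$ consider, for $0\le j\le N$ and with $v_{-1}=0$, $v_{N+1}=a v_N$, $$I_1v_j=\frac{i\varepsilon}{1-q^{-2N+2j-1}}\Bigl(-q\tfrac{(1-q^j)(1-q^{-2N-2+j})}{q-q^{-1}}F_j\,v_{j-1}+q^{-N-1+j}v_{j+1}\Bigr),$$ $$I_2v_j=\frac{i}{1-q^{-2N+2j-1}}\Bigl(-q^{N-j+2}\tfrac{(1-q^j)(1-q^{-2N-2+j})}{q-q^{-1}}F_j\,v_{j-1}+q^{-2N+2j-1}v_{j+1}\Bigr),$$ $$I_3v_j=\varepsilon\frac{q^{N-j+1/2}+q^{-N+j-1/2}}{q-q^{-1}}v_j .$$ *Classical representation.* Let $x\in\mathbb C\setminus\{0\}$ (written $x=q^\mu$) satisfy $$(q^{(N+1)/2}+q^{-(N+1)/2})\,\frac{xq^{-N/2}-x^{-1}q^{N/2}}{q-q^{-1}}=-i\,c\,A_3,\qquad(1)$$ put $G_j=(1-q^j)(1-q^{j-N-1})(1+x^{-2}q^{j-1})(1+x^{-2}q^{j+N})$ and consider, for $0\le j\le N$ and with $v_{-1}=v_{N+1}=0$, $$I_1v_j=\frac{-xq^{-j+3/2}}{(1+x^{-2}q^{2j})(q-q^{-1})^2}G_j\,v_{j-1}-\frac{x^{-1}q^{j-1/2}}{1+x^{-2}q^{2j}}v_{j+1},$$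 $$I_2v_j=\frac{i\,x^2q^{-2j+2}}{(1+x^{-2}q^{2j})(q-q^{-1})^2}G_j\,v_{j-1}-\frac{i\,x^{-2}q^{2j}}{1+x^{-2}q^{2j}}v_{j+1},\qquad I_3v_j=-i\frac{xq^{-j}-x^{-1}q^j}{q-q^{-1}}v_j .$$ *Excluded values.* For $k\in\{-1,0,\dots,2N+1\}$ and $\varepsilon\in\{1,-1\}$ consider the equality $$\frac{(q^{(N+1)/2}+q^{-(N+1)/2})(q^{(k-N)/2}+q^{-(k-N)/2})}{q-q^{-1}}=-\varepsilon\,c\,A_3.\qquad(2)$$ **Theorem.** For every $(\varepsilon,a)\in P$ the non-classical formulas define a representation of $\mathrm{AW}_q(0,0,A_3)$; in it neither $2/(q-q^{-1})$ nor $-2/(q-q^{-1})$ is an eigenvalue of $I_3$, different pairs in $P$ give inequivalent representations, and the representation is irreducible if and only if $F_j\ne0$ for all $j\in\{1,\dots,N\}$. Moreover: 1. Suppose that (2) fails for all $k$ and all $\varepsilon$. Then $P$ has exactly four elements, (1) has a solution, and for every solution $x$ of (1) the classical formulas define an irreducible representation of $\mathrm{AW}_q(0,0,A_3)$ in which $\pm2/(q-q^{-1})$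 are not eigenvalues of $I_3$ and which is not equivalent to any of the four non-classical ones. Every irreducible representation of $\mathrm{AW}_q(0,0,A_3)$ of dimension $N+1$ for which $\pm2/(q-q^{-1})$ are not eigenvalues of $I_3$ is equivalent to one of these five pairwise inequivalent representations. 2. Suppose that (2) holds for some $k$ and some $\varepsilon$. Then $P$ has exactly four elements if $k\notin\{-1,2N+1\}$ and exactly three if $k\in\{-1,2N+1\}$, and every irreducible representation of $\mathrm{AW}_q(0,0,A_3)$ of dimension $N+1$ for which $\pm2/(q-q^{-1})$ are not eigenvalues of $I_3$ is equivalent to one of the non-classical representations belonging to the pairs in $P$. -/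

import Mathlib

/-!
Conventions: `q` is the deformation parameter and `s` a fixed square root of it (`s ^ 2 = q`), so
that `q^{n/2}` is `s ^ n` for an integer `n`. A complex power `q^μ` is represented by its value `x`.
-/

noncomputable section

namespace AskeyWilson

/-- The defining relations of the Askey-Wilson algebra on the free algebra with generators
`I₁ = ι 0`, `I₂ = ι 1`, `I₃ = ι 2`. -/
inductive Rel (s A₁ A₂ A₃ : ℂ) : FreeAlgebra ℂ (Fin 3) → FreeAlgebra ℂ (Fin 3) → Prop
  | rel₁ : Rel s A₁ A₂ A₃
      (s • (FreeAlgebra.ι ℂ 0 * FreeAlgebra.ι ℂ 1)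
        - s⁻¹ • (FreeAlgebra.ι ℂ 1 * FreeAlgebra.ι ℂ 0))
      (FreeAlgebra.ι ℂ 2 + algebraMap ℂ _ A₃)
  | rel₂ : Rel s A₁ A₂ A₃
      (s • (FreeAlgebra.ι ℂ 1 * FreeAlgebra.ι ℂ 2)
        - s⁻¹ • (FreeAlgebra.ι ℂ 2 * FreeAlgebra.ι ℂ 1))
      (FreeAlgebra.ι ℂ 0 + algebraMap ℂ _ A₁)
  | rel₃ : Rel s A₁ A₂ A₃
      (s • (FreeAlgebra.ι ℂ 2 * FreeAlgebra.ι ℂ 0)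
        - s⁻¹ • (FreeAlgebra.ι ℂ 0 * FreeAlgebra.ι ℂ 2))
      (FreeAlgebra.ι ℂ 1 + algebraMap ℂ _ A₂)

/-- The Askey-Wilson algebra `AW_q(A₁, A₂, A₃)`, where `q = s ^ 2`. -/
abbrev AW (s A₁ A₂ A₃ : ℂ) : Type := RingQuot (Rel s A₁ A₂ A₃)

/-- The generators: `gen 0 = I₁`, `gen 1 = I₂`, `gen 2 = I₃`. -/
def gen {s A₁ A₂ A₃ : ℂ} (i : Fin 3) : AW s A₁ A₂ A₃ :=
  RingQuot.mkAlgHom ℂ (Rel s A₁ A₂ A₃) (FreeAlgebra.ι ℂ i)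

/-- A representation of a complex algebra `A` on `V` is irreducible if `V ≠ 0` and the only
invariant subspaces are `0` and `V`. -/
def IsIrreducible {A : Type*} [Ring A] [Algebra ℂ A] {V : Type*} [AddCommGroup V] [Module ℂ V]
    (ρ : A →ₐ[ℂ] Module.End ℂ V) : Prop :=
  Nontrivial V ∧
    ∀ W : Submodule ℂ V, (∀ a : A, ∀ w ∈ W, ρ a w ∈ W) → W = ⊥ ∨ W = ⊤

/-- Equivalence of two representations of `A`. -/
def IsEquivRep {A : Type*} [Ring A] [Algebra ℂ A]
    {V : Type*} [AddCommGroup V] [Module ℂ V] {V' : Type*} [AddCommGroup V'] [Module ℂ V']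
    (ρ : A →ₐ[ℂ] Module.End ℂ V) (ρ' : A →ₐ[ℂ] Module.End ℂ V') : Prop :=
  ∃ φ : V ≃ₗ[ℂ] V', ∀ a : A, ∀ v : V, φ (ρ a v) = ρ' a (φ v)

/-- Neither `2 / (q - q⁻¹)` nor `-2 / (q - q⁻¹)` is an eigenvalue of `I₃`. -/
def AvoidsEigenvalues {s A₁ A₂ A₃ : ℂ} {V : Type*} [AddCommGroup V] [Module ℂ V] (q : ℂ)
    (ρ : AW s A₁ A₂ A₃ →ₐ[ℂ] Module.End ℂ V) : Prop :=
  ∀ ε : ℂ, ε = 1 ∨ ε = -1 → ¬ (ρ (gen 2)).HasEigenvalue (2 * ε / (q - q⁻¹))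

/-- Representations of `AW_q(0, 0, A₃)` on the coordinate space with basis `v_0, …, v_N`. -/
abbrev CoordRep (s A₃ : ℂ) (N : ℕ) : Type :=
  AW s 0 0 A₃ →ₐ[ℂ] Module.End ℂ (Fin (N + 1) → ℂ)

/-- `ρ` represents `I₁, I₂, I₃` by the matrices `M₁, M₂, M₃`. -/
def HasMatrices {s A₃ : ℂ} {N : ℕ} (ρ : CoordRep s A₃ N)
    (M₁ M₂ M₃ : Matrix (Fin (N + 1)) (Fin (N + 1)) ℂ) : Prop :=
  ρ (gen 0) = Matrix.toLin' M₁ ∧ ρ (gen 1) = Matrix.toLin' M₂ ∧ ρ (gen 2) = Matrix.toLin' M₃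

/-- The matrix of the operator `v_j ↦ down j • v_{j-1} + up j • v_{j+1}`, `0 ≤ j ≤ N`, with the
conventions `v_{-1} = 0` and `v_{N+1} = a • v_N`. -/
def shiftMatrix (N : ℕ) (a : ℂ) (down up : ℤ → ℂ) : Matrix (Fin (N + 1)) (Fin (N + 1)) ℂ :=
  Matrix.of fun i j =>
    (if (i : ℕ) + 1 = j then down (j : ℕ) else 0)
      + (if (i : ℕ) = j + 1 then up (j : ℕ) else 0)
      + (if (i : ℕ) = N ∧ (j : ℕ) = N then a * up N else 0)

/-! ### The classical representation, `x = q^μ` -/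

/-- The condition on `x = q^μ`:
`(q^{(N+1)/2} + q^{-(N+1)/2}) [μ - N/2]_q = -i (q^{1/2} + q^{-1/2}) A₃`. -/
def IsClassicalParam (q s A₃ : ℂ) (N : ℕ) (x : ℂ) : Prop :=
  x ≠ 0 ∧
    (s ^ (N + 1 : ℤ) + s ^ (-(N + 1) : ℤ))
        * ((x * s ^ (-N : ℤ) - x⁻¹ * s ^ (N : ℤ)) / (q - q⁻¹))
      = -Complex.I * (s + s⁻¹) * A₃

/-- The product `(1-q^j)(1-q^{j-N-1})(1+q^{-2μ+j-1})(1+q^{-2μ+j+N})`. -/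
def classicalFactor (q : ℂ) (N : ℕ) (x : ℂ) (j : ℤ) : ℂ :=
  (1 - q ^ j) * (1 - q ^ (j - N - 1)) * (1 + x ^ (-2 : ℤ) * q ^ (j - 1))
    * (1 + x ^ (-2 : ℤ) * q ^ (j + N))

def classicalI₁ (q s : ℂ) (N : ℕ) (x : ℂ) : Matrix (Fin (N + 1)) (Fin (N + 1)) ℂ :=
  shiftMatrix N 0
    (fun j => -(x * s ^ (3 - 2 * j))
      / ((1 + x ^ (-2 : ℤ) * q ^ (2 * j)) * (q - q⁻¹) ^ 2) * classicalFactor q N x j)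
    (fun j => -(x⁻¹ * s ^ (2 * j - 1)) / (1 + x ^ (-2 : ℤ) * q ^ (2 * j)))

def classicalI₂ (q : ℂ) (N : ℕ) (x : ℂ) : Matrix (Fin (N + 1)) (Fin (N + 1)) ℂ :=
  shiftMatrix N 0
    (fun j => Complex.I * (x ^ 2 * q ^ (2 - 2 * j))
      / ((1 + x ^ (-2 : ℤ) * q ^ (2 * j)) * (q - q⁻¹) ^ 2) * classicalFactor q N x j)
    (fun j => -Complex.I * (x ^ (-2 : ℤ) * q ^ (2 * j)) / (1 + x ^ (-2 : ℤ) * q ^ (2 * j)))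

def classicalI₃ (q : ℂ) (N : ℕ) (x : ℂ) : Matrix (Fin (N + 1)) (Fin (N + 1)) ℂ :=
  Matrix.diagonal fun j =>
    -Complex.I * ((x * q ^ (-(j : ℕ) : ℤ) - x⁻¹ * q ^ ((j : ℕ) : ℤ)) / (q - q⁻¹))

/-! ### The non-classical representations -/

/-- The pairs `(ε, a)` with `ε = ±1` and
`a² = -q [N+1]_q² - ε q (q^{1/2}+q^{-1/2}) (q^{(N+1)/2}-q^{-(N+1)/2})² / (q-q⁻¹) A₃`. -/
def nonclassicalParams (q s A₃ : ℂ) (N : ℕ) : Set (ℂ × ℂ) :=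
  {p | (p.1 = 1 ∨ p.1 = -1) ∧
    p.2 ^ 2 = -q * ((q ^ (N + 1 : ℤ) - q ^ (-(N + 1) : ℤ)) / (q - q⁻¹)) ^ 2
      - p.1 * q * (s + s⁻¹) * (s ^ (N + 1 : ℤ) - s ^ (-(N + 1) : ℤ)) ^ 2 / (q - q⁻¹) * A₃}

/-- The factor
`q^{N+1-j} (1+q^j) (1+q^{-2N-2+j}) / (q-q⁻¹) + ε (q^{1/2}+q^{-1/2}) A₃`. -/
def nonclassicalFactor (q s A₃ : ℂ) (N : ℕ) (ε : ℂ) (j : ℤ) : ℂ :=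
  q ^ (N + 1 - j) * (1 + q ^ j) * (1 + q ^ (-2 * N - 2 + j)) / (q - q⁻¹) + ε * (s + s⁻¹) * A₃

def nonclassicalI₁ (q s A₃ : ℂ) (N : ℕ) (ε a : ℂ) : Matrix (Fin (N + 1)) (Fin (N + 1)) ℂ :=
  shiftMatrix N a
    (fun j => Complex.I * ε / (1 - q ^ (-2 * N + 2 * j - 1))
      * (-q * ((1 - q ^ j) * (1 - q ^ (-2 * N - 2 + j)) / (q - q⁻¹))
        * nonclassicalFactor q s A₃ N ε j))
    (fun j => Complex.I * ε / (1 - q ^ (-2 * N + 2 * j - 1)) * q ^ (-N - 1 + j))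

def nonclassicalI₂ (q s A₃ : ℂ) (N : ℕ) (ε a : ℂ) : Matrix (Fin (N + 1)) (Fin (N + 1)) ℂ :=
  shiftMatrix N a
    (fun j => Complex.I / (1 - q ^ (-2 * N + 2 * j - 1))
      * (-q ^ (N - j + 2) * ((1 - q ^ j) * (1 - q ^ (-2 * N - 2 + j)) / (q - q⁻¹))
        * nonclassicalFactor q s A₃ N ε j))
    (fun j => Complex.I / (1 - q ^ (-2 * N + 2 * j - 1)) * q ^ (-2 * N + 2 * j - 1))

def nonclassicalI₃ (q s : ℂ) (N : ℕ) (ε : ℂ) : Matrix (Fin (N + 1)) (Fin (N + 1)) ℂ :=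
  Matrix.diagonal fun j =>
    ε * ((s ^ (2 * (N - (j : ℕ)) + 1 : ℤ) + s ^ (-(2 * (N - (j : ℕ)) + 1) : ℤ)) / (q - q⁻¹))

/-- `A₃` is the excluded value with index `k` and sign `ε`:
`(q^{(N+1)/2}+q^{-(N+1)/2}) (q^{(k-N)/2}+q^{-(k-N)/2}) / (q-q⁻¹) = -ε (q^{1/2}+q^{-1/2}) A₃`. -/
def IsExcluded (q s A₃ : ℂ) (N : ℕ) (k : ℤ) (ε : ℂ) : Prop :=
  (s ^ (N + 1 : ℤ) + s ^ (-(N + 1) : ℤ)) * (s ^ (k - N) + s ^ (-(k - N))) / (q - q⁻¹)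
    = -ε * (s + s⁻¹) * A₃

end AskeyWilson

end

noncomputable section

namespace AskeyWilson

/-! Write an eigenvalue of `I₃` as `(y + y⁻¹)/(q - q⁻¹)`; the parameter `y` is determined up to
inversion. The second and third relations imply that `I₁ - s⁻¹ y I₂` carries the eigenspace of `y`
into that of `q y`. Since `y⁻¹` is a parameter of the same eigenspace, `I₁ - s⁻¹ y⁻¹ I₂` carries it
into that of `y / q`. Away from `y = ±1` these two operators recover `I₁` and `I₂`, and the first
relation becomes a recursion for the product of a raising and a lowering step, which `potential`
integrates. An irreducible representation is therefore one ladder, known up to equivalence from its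
length, its bottom parameter `z` and the action of the lowering operator at the bottom.

The parameters `±s` are special: lowering from `±s` leads to `±s⁻¹`, hence back to the same
eigenspace. If one of them occurs, an eigenvector of this loop with eigenvalue `t` generates a
ladder, and termination after `N + 1` vectors forces `t² = P(z⁻¹) - P(z q^N)`, where `P` is the
potential. Up to scaling this is the condition on `a`, so the representation is non-classical. If
neither occurs, the ladder ends with zero on both sides, and `P(z⁻¹) = P(z q^N)` becomes an equation
for `w + w⁻¹` with `w = q^{N/2} z`. Its two solutions describe the same ladder read from its two
ends, which leaves one classical candidate. The excluded values are those with `w = ±s^(k - N)`: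
such a ladder would meet a parameter `±1`, `±s` or `±s⁻¹`, so only the non-classical representations
remain.

The main lemmas are `RelationsAt.ladder`, `climb_irreducible` and `exists_linearEquiv_of_climb`.
Conversely, `LadderData.relationsAt` and `LadderData.irreducible_iff` treat the explicit matrices.
-/

/-! ### Spectral parameters, the potential and powers of a generic `s`. -/

/-- The eigenvalue of `I₃` with spectral parameter `y`. -/
def spec (s y : ℂ) : ℂ := (y + y⁻¹) / (s ^ 2 - (s ^ 2)⁻¹)

/-- The first integral of the recursion for the ladder coefficients. -/
def potential (s A₃ y : ℂ) : ℂ :=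
  -((s * y + (s * y)⁻¹) * (s * y + (s * y)⁻¹ + A₃ * (s + s⁻¹) * (s ^ 2 - (s ^ 2)⁻¹)))
    / (s ^ 2 * (s ^ 2 - (s ^ 2)⁻¹) ^ 2)

/-- The ladder operator, mapping the eigenspace of `I₃` with parameter `y` to that with parameter
`q y`. -/
def shiftOp {V : Type*} [AddCommGroup V] [Module ℂ V] (s : ℂ) (X₁ X₂ : Module.End ℂ V) (y : ℂ) :
    Module.End ℂ V :=
  X₁ - (s⁻¹ * y) • X₂

theorem shiftOp_apply {V : Type*} [AddCommGroup V] [Module ℂ V] (s : ℂ) (X₁ X₂ : Module.End ℂ V)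
    (y : ℂ) (v : V) : shiftOp s X₁ X₂ y v = X₁ v - (s⁻¹ * y) • X₂ v := rfl

/-- The defining relations of `AW_q(0, 0, A₃)`, evaluated at a vector `v`. -/
structure RelationsAt {V : Type*} [AddCommGroup V] [Module ℂ V] (s A₃ : ℂ)
    (X₁ X₂ X₃ : Module.End ℂ V) (v : V) : Prop where
  rel₁ : s • X₁ (X₂ v) - s⁻¹ • X₂ (X₁ v) = X₃ v + A₃ • v
  rel₂ : s • X₂ (X₃ v) - s⁻¹ • X₃ (X₂ v) = X₁ v
  rel₃ : s • X₃ (X₁ v) - s⁻¹ • X₁ (X₃ v) = X₂ v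

/-- `s` is nonzero and not a root of unity. -/
structure Generic (s : ℂ) : Prop where
  ne_zero : s ≠ 0
  zpow_ne_one : ∀ n : ℤ, n ≠ 0 → s ^ n ≠ 1

namespace Generic

variable {s : ℂ}

theorem zpow_ne_neg_one (hs : Generic s) (n : ℤ) : s ^ n ≠ -1 := by
  intro h
  by_cases hn : n = 0
  · subst hn; norm_num at h
  · apply hs.zpow_ne_one (n * 2) (by omega)
    rw [zpow_mul, h]; norm_num

theorem zpow_injective (hs : Generic s) {m n : ℤ} (h : s ^ m = s ^ n) : m = n := by
  by_contra hmn
  apply hs.zpow_ne_one (m - n) (by omega)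
  rw [zpow_sub₀ hs.ne_zero, h, div_self (zpow_ne_zero _ hs.ne_zero)]

theorem zpow_ne_neg_zpow (hs : Generic s) (m n : ℤ) : s ^ m ≠ -s ^ n := by
  intro h
  apply hs.zpow_ne_neg_one (m - n)
  rw [zpow_sub₀ hs.ne_zero, h, neg_div, div_self (zpow_ne_zero _ hs.ne_zero)]

theorem zpow_eq_or_eq_neg (hs : Generic s) {m n : ℤ} (h : s ^ m = s ^ n ∨ s ^ m = -s ^ n) :
    m = n :=
  h.elim hs.zpow_injective fun h => (hs.zpow_ne_neg_zpow m n h).elim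

theorem sq_ne_one (hs : Generic s) : s ^ 2 ≠ 1 := by
  exact_mod_cast hs.zpow_ne_one 2 (by norm_num)

theorem pow_four_ne_one (hs : Generic s) : s ^ 4 ≠ 1 := by
  exact_mod_cast hs.zpow_ne_one 4 (by norm_num)

theorem sub_inv_ne_zero (hs : Generic s) : s ^ 2 - (s ^ 2)⁻¹ ≠ 0 := by
  have h0 := hs.ne_zero
  have h4 := hs.pow_four_ne_one
  intro h
  field_simp at h
  apply h4
  linear_combination h

theorem zpow_add_zpow_neg_ne_zero (hs : Generic s) (n : ℤ) : s ^ n + s ^ (-n) ≠ 0 := fun h =>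
  hs.zpow_ne_neg_zpow n (-n) (by linear_combination h)

end Generic

theorem spec_inv (s y : ℂ) : spec s y⁻¹ = spec s y := by
  rw [spec, spec, inv_inv, add_comm]

/-- The difference of the two sides factors as `(y - y')(y y' - 1)` up to a unit. The second factor
is the source of all coincidences of eigenvalues along a ladder. -/
theorem spec_eq_spec_iff {s y y' : ℂ} (hs : Generic s) (hy : y ≠ 0) (hy' : y' ≠ 0) :
    spec s y = spec s y' ↔ y = y' ∨ y * y' = 1 := by
  have h := hs.sub_inv_ne_zero
  rw [spec, spec, div_left_inj' h]
  have key : (y + y⁻¹ - (y' + y'⁻¹)) * (y * y') = (y - y') * (y * y' - 1) := by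
    field_simp; ring
  constructor
  · intro e
    rw [sub_eq_zero.2 e, zero_mul] at key
    rcases mul_eq_zero.1 key.symm with h | h
    · exact Or.inl (sub_eq_zero.1 h)
    · exact Or.inr (sub_eq_zero.1 h)
  · rintro (rfl | e)
    · rfl
    · rw [eq_inv_of_mul_eq_one_left e, inv_inv, add_comm]

theorem exists_spec_eq {s : ℂ} (hs : Generic s) (μ : ℂ) : ∃ y, y ≠ 0 ∧ spec s y = μ := by
  have h := hs.sub_inv_ne_zero
  set k := s ^ 2 - (s ^ 2)⁻¹ with hk
  -- `r` is half a square root of the discriminant of `y² - μ k y + 1`; the other root of this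
  -- polynomial is `y⁻¹`.
  obtain ⟨r, hr⟩ := IsAlgClosed.exists_pow_nat_eq ((μ * k) ^ 2 / 4 - 1) (n := 2) (by norm_num)
  have hprod : (μ * k / 2 + r) * (μ * k / 2 - r) = 1 := by linear_combination -hr
  refine ⟨μ * k / 2 + r, left_ne_zero_of_mul_eq_one hprod, ?_⟩
  rw [spec, ← hk, inv_eq_of_mul_eq_one_right hprod]
  field_simp
  ring

/-- The potential depends on `s y + (s y)⁻¹` only, and `y ↦ (q y)⁻¹` inverts `s y`. This makes the
recursion along a ladder telescope. -/
theorem potential_inv (s A₃ y : ℂ) (hs : s ≠ 0) :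
    potential s A₃ (s ^ 2 * y)⁻¹ = potential s A₃ y := by
  have : s * (s ^ 2 * y)⁻¹ = (s * y)⁻¹ := by
    by_cases hy : y = 0
    · simp [hy]
    · field_simp
  rw [potential, potential, this, inv_inv, add_comm (s * y)⁻¹]

/-- The potential is a quadratic polynomial in `s y + (s y)⁻¹`, so its differences split into two
linear factors. -/
theorem potential_sub (s A₃ y y' : ℂ) :
    potential s A₃ y - potential s A₃ y' =
      -((s * y + (s * y)⁻¹ - (s * y' + (s * y')⁻¹)) *
        (s * y + (s * y)⁻¹ + (s * y' + (s * y')⁻¹) + A₃ * (s + s⁻¹) * (s ^ 2 - (s ^ 2)⁻¹)))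
      / (s ^ 2 * (s ^ 2 - (s ^ 2)⁻¹) ^ 2) := by
  rw [potential, potential, ← sub_div]
  ring

theorem potential_sub_inv {s A₃ y : ℂ} (hs : Generic s) (hy : y ≠ 0) :
    potential s A₃ y - potential s A₃ y⁻¹ = (s ^ 2)⁻¹ * (y⁻¹ - y) * (spec s y + A₃) := by
  have h0 := hs.ne_zero
  have h := hs.sub_inv_ne_zero
  have h4 : s ^ 4 - 1 ≠ 0 := sub_ne_zero.2 hs.pow_four_ne_one
  have e : s ^ 2 - (s ^ 2)⁻¹ = (s ^ 4 - 1) / s ^ 2 := by field_simp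
  rw [potential_sub, spec, e]
  field_simp
  ring

/-! ### The relations expressed through ladder operators. -/

section Module

variable {V : Type*} [AddCommGroup V] [Module ℂ V] {s A₃ : ℂ} {X₁ X₂ X₃ : Module.End ℂ V}

/-- The four parameters are matched so that the squares of `X₁` and of `X₂` cancel, leaving a
multiple of the left-hand side of the first relation. -/
theorem shiftOp_shiftOp_sub (y : ℂ) (hs : s ≠ 0) (hy : y ≠ 0) (v : V) :
    shiftOp s X₁ X₂ (s ^ 2 * y)⁻¹ (shiftOp s X₁ X₂ y v)
      - shiftOp s X₁ X₂ (y / s ^ 2) (shiftOp s X₁ X₂ y⁻¹ v)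
      = ((s ^ 2)⁻¹ * (y⁻¹ - y)) • (s • X₁ (X₂ v) - s⁻¹ • X₂ (X₁ v)) := by
  simp only [shiftOp_apply, map_sub, map_smul]
  match_scalars <;> field_simp <;> ring

/-- The ladder identity on the eigenspace of `I₃` with parameter `y`. -/
theorem RelationsAt.ladder {v : V} {y : ℂ} (hs : Generic s) (hy : y ≠ 0)
    (h : RelationsAt s A₃ X₁ X₂ X₃ v) (hv : X₃ v = spec s y • v) :
    shiftOp s X₁ X₂ (s ^ 2 * y)⁻¹ (shiftOp s X₁ X₂ y v)
      - shiftOp s X₁ X₂ (y / s ^ 2) (shiftOp s X₁ X₂ y⁻¹ v)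
      = (potential s A₃ y - potential s A₃ y⁻¹) • v := by
  rw [shiftOp_shiftOp_sub y hs.ne_zero hy, h.rel₁, hv, potential_sub_inv hs hy, ← add_smul,
    smul_smul]

/-- By the second and third relations `X₃` acts on the pair `X₁ v`, `X₂ v` through a 2 × 2 matrix
with eigenvalues `spec s (q y)` and `spec s (y / q)`; the combination here is an eigenvector for the
first of them. -/
theorem RelationsAt.apply_shiftOp {v : V} {y : ℂ} (hs : Generic s) (hy : y ≠ 0)
    (h : RelationsAt s A₃ X₁ X₂ X₃ v) (hv : X₃ v = spec s y • v) :
    X₃ (shiftOp s X₁ X₂ y v) = spec s (s ^ 2 * y) • shiftOp s X₁ X₂ y v := by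
  have h0 := hs.ne_zero
  have hk := hs.sub_inv_ne_zero
  have h4 : s ^ 4 - 1 ≠ 0 := sub_ne_zero.2 hs.pow_four_ne_one
  have e : s ^ 2 - (s ^ 2)⁻¹ = (s ^ 4 - 1) / s ^ 2 := by field_simp
  have e2 : X₃ (X₂ v) = (s ^ 2 * spec s y) • X₂ v - s • X₁ v := by
    have := h.rel₂
    rw [hv, map_smul] at this
    rw [← this]
    match_scalars <;> field_simp
    ring
  have e3 : X₃ (X₁ v) = ((s ^ 2)⁻¹ * spec s y) • X₁ v + s⁻¹ • X₂ v := by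
    have := h.rel₃
    rw [hv, map_smul] at this
    rw [← this]
    match_scalars <;> field_simp
    ring
  rw [shiftOp_apply, map_sub, map_smul, e2, e3, spec, spec, e]
  match_scalars <;> field_simp <;> ring

/-- The raising and lowering operators at `v` are two linear equations for `X₁ v` and `X₂ v`,
independent exactly when `y ≠ y⁻¹`. This is why the eigenvalues `±2/(q - q⁻¹)` have to be excluded.
-/
theorem second_eq_shiftOp (hs : s ≠ 0) {y : ℂ} (hy : y ≠ 0) (hy2 : y ^ 2 ≠ 1) (v : V) :
    X₂ v = (s * y / (y ^ 2 - 1)) • (shiftOp s X₁ X₂ y⁻¹ v - shiftOp s X₁ X₂ y v) := by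
  have : y ^ 2 - 1 ≠ 0 := sub_ne_zero.2 hy2
  simp only [shiftOp_apply]
  match_scalars <;> field_simp <;> ring

theorem first_eq_shiftOp (hs : s ≠ 0) {y : ℂ} (hy2 : y ^ 2 ≠ 1) (v : V) :
    X₁ v = (y ^ 2 - 1)⁻¹ • (y ^ 2 • shiftOp s X₁ X₂ y⁻¹ v - shiftOp s X₁ X₂ y v) := by
  have : y ^ 2 - 1 ≠ 0 := sub_ne_zero.2 hy2
  simp only [shiftOp_apply]
  match_scalars <;> field_simp
  ring

/-- The relations at an eigenvector of `I₃` follow from those of the ladder operators. -/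
theorem relationsAt_of_ladder {v : V} {y : ℂ} (hs : Generic s) (hy : y ≠ 0) (hy2 : y ^ 2 ≠ 1)
    (hv : X₃ v = spec s y • v)
    (hup : X₃ (shiftOp s X₁ X₂ y v) = spec s (s ^ 2 * y) • shiftOp s X₁ X₂ y v)
    (hdown : X₃ (shiftOp s X₁ X₂ y⁻¹ v) = spec s (y / s ^ 2) • shiftOp s X₁ X₂ y⁻¹ v)
    (hlad : shiftOp s X₁ X₂ (s ^ 2 * y)⁻¹ (shiftOp s X₁ X₂ y v)
      - shiftOp s X₁ X₂ (y / s ^ 2) (shiftOp s X₁ X₂ y⁻¹ v)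
      = (potential s A₃ y - potential s A₃ y⁻¹) • v) :
    RelationsAt s A₃ X₁ X₂ X₃ v := by
  have h0 := hs.ne_zero
  have hk := hs.sub_inv_ne_zero
  have h4 : s ^ 4 - 1 ≠ 0 := sub_ne_zero.2 hs.pow_four_ne_one
  have e : s ^ 2 - (s ^ 2)⁻¹ = (s ^ 4 - 1) / s ^ 2 := by field_simp
  have hyy : y ^ 2 - 1 ≠ 0 := sub_ne_zero.2 hy2
  have e1 := first_eq_shiftOp (X₁ := X₁) (X₂ := X₂) h0 hy2 v
  have e2 := second_eq_shiftOp (X₁ := X₁) (X₂ := X₂) h0 hy hy2 v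
  refine ⟨?_, ?_, ?_⟩
  · rw [shiftOp_shiftOp_sub y h0 hy, potential_sub_inv hs hy,
      mul_smul _ (spec s y + A₃)] at hlad
    -- The ladder identity is the first relation multiplied by this scalar, which can be cancelled
    -- because `y² ≠ 1`.
    have hne : (s ^ 2)⁻¹ * (y⁻¹ - y) ≠ 0 := by
      refine mul_ne_zero (inv_ne_zero (pow_ne_zero _ h0)) fun h => hyy ?_
      field_simp at h
      linear_combination -h
    rw [smul_right_injective V hne hlad, hv, add_smul]
  · rw [hv, map_smul]
    generalize shiftOp s X₁ X₂ y v = a at *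
    generalize shiftOp s X₁ X₂ y⁻¹ v = b at *
    rw [e2, e1, map_smul, map_sub, hup, hdown, spec, spec, spec, e]
    match_scalars <;> field_simp <;> ring
  · rw [hv, map_smul]
    generalize shiftOp s X₁ X₂ y v = a at *
    generalize shiftOp s X₁ X₂ y⁻¹ v = b at *
    rw [e2, e1, map_smul, map_sub, map_smul, hup, hdown, spec, spec, spec, e]
    match_scalars <;> field_simp <;> ring

end Module

/-! ### Ladders generated by a bottom vector. -/

section Climb

variable {V : Type*} [AddCommGroup V] [Module ℂ V] {s A₃ : ℂ} {X₁ X₂ X₃ : Module.End ℂ V}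

/-- Repeated application of the ladder operators, starting from parameter `z`. -/
def climb (s : ℂ) (X₁ X₂ : Module.End ℂ V) (z : ℂ) (u : V) : ℕ → V
  | 0 => u
  | i + 1 => shiftOp s X₁ X₂ (z * (s ^ 2) ^ i) (climb s X₁ X₂ z u i)

/-- A vector that generates a ladder: either the lowering operator kills it, or its parameter is
`±s` and the lowering operator acts on it by the scalar `t`. -/
structure IsBottom (s : ℂ) (X₁ X₂ X₃ : Module.End ℂ V) (z t : ℂ) (u : V) : Prop where
  param_ne_zero : z ≠ 0
  eigen : X₃ u = spec s z • u
  lower : shiftOp s X₁ X₂ z⁻¹ u = t • u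
  loop : t = 0 ∨ z ^ 2 = s ^ 2

theorem shiftOp_climb (z : ℂ) (u : V) (i : ℕ) :
    shiftOp s X₁ X₂ (z * (s ^ 2) ^ i) (climb s X₁ X₂ z u i) = climb s X₁ X₂ z u (i + 1) := rfl

theorem climb_eigen (hs : Generic s) (h : ∀ v, RelationsAt s A₃ X₁ X₂ X₃ v) {z : ℂ} {u : V}
    (hz : z ≠ 0) (hu : X₃ u = spec s z • u) (i : ℕ) :
    X₃ (climb s X₁ X₂ z u i) = spec s (z * (s ^ 2) ^ i) • climb s X₁ X₂ z u i := by
  have h0 := hs.ne_zero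
  induction i with
  | zero => simpa [climb] using hu
  | succ i ih =>
    have := (h _).apply_shiftOp hs (by positivity) ih
    rw [shiftOp_climb] at this
    rw [this]
    congr 2
    ring

/-- The coefficient of raising and then lowering, minus the potential of the current parameter, does
not change from rung to rung; its value is fixed at the bottom by `t`. -/
theorem shiftOp_inv_climb_succ (hs : Generic s) (h : ∀ v, RelationsAt s A₃ X₁ X₂ X₃ v) {z t : ℂ}
    {u : V} (hu : IsBottom s X₁ X₂ X₃ z t u) (i : ℕ) :
    shiftOp s X₁ X₂ (z * (s ^ 2) ^ (i + 1))⁻¹ (climb s X₁ X₂ z u (i + 1)) =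
      (t ^ 2 + potential s A₃ (z * (s ^ 2) ^ i) - potential s A₃ z⁻¹) •
        climb s X₁ X₂ z u i := by
  have h0 := hs.ne_zero
  have hz := hu.param_ne_zero
  have key := fun i => (h _).ladder hs (mul_ne_zero hz (pow_ne_zero i (pow_ne_zero 2 h0)))
    (climb_eigen hs h hz hu.eigen i)
  have e : ∀ i, s ^ 2 * (z * (s ^ 2) ^ i) = z * (s ^ 2) ^ (i + 1) := fun i => by ring
  have e' : ∀ i, z * (s ^ 2) ^ (i + 1) / s ^ 2 = z * (s ^ 2) ^ i := fun i => by
    field_simp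
    exact pow_succ' _ _
  simp only [shiftOp_climb, e] at key
  induction i with
  | zero =>
    have k := key 0
    -- In the loop case `z / q = z⁻¹`, so the second operator is again the lowering operator at the
    -- bottom and contributes another factor `t`.
    have hl : shiftOp s X₁ X₂ (z / s ^ 2) (t • u) = t ^ 2 • u := by
      rcases hu.loop with ht | ht
      · simp [ht]
      · have : z / s ^ 2 = z⁻¹ := by rw [← ht]; field_simp
        rw [this, map_smul, hu.lower, smul_smul, pow_two]
    simp only [pow_zero, mul_one, climb] at k ⊢
    rw [hu.lower, hl] at k
    rw [eq_add_of_sub_eq k, ← add_smul]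
    congr 1
    ring
  | succ i ih =>
    have k := key (i + 1)
    rw [ih, e', map_smul, shiftOp_climb] at k
    rw [eq_add_of_sub_eq k, ← add_smul]
    congr 1
    rw [← e i, potential_inv _ _ _ h0]
    ring

/-- Closure under the ladder operators suffices, because away from `y² = 1` they determine `X₁` and
`X₂`. -/
theorem span_invariant (hs : s ≠ 0) {S : Set V}
    (h : ∀ v ∈ S, ∃ y, y ≠ 0 ∧ y ^ 2 ≠ 1 ∧ X₃ v = spec s y • v ∧
      shiftOp s X₁ X₂ y v ∈ Submodule.span ℂ S ∧ shiftOp s X₁ X₂ y⁻¹ v ∈ Submodule.span ℂ S) :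
    ∀ w ∈ Submodule.span ℂ S, X₁ w ∈ Submodule.span ℂ S ∧ X₂ w ∈ Submodule.span ℂ S ∧
      X₃ w ∈ Submodule.span ℂ S := by
  intro w hw
  induction hw using Submodule.span_induction with
  | mem v hv =>
    obtain ⟨y, hy, hy2, h3, hu, hd⟩ := h v hv
    rw [first_eq_shiftOp (X₁ := X₁) (X₂ := X₂) hs hy2 v,
      second_eq_shiftOp (X₁ := X₁) (X₂ := X₂) hs hy hy2 v, h3]
    exact ⟨Submodule.smul_mem _ _ (Submodule.sub_mem _ (Submodule.smul_mem _ _ hd) hu),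
      Submodule.smul_mem _ _ (Submodule.sub_mem _ hd hu),
      Submodule.smul_mem _ _ (Submodule.subset_span hv)⟩
  | zero => simp
  | add x y _ _ hx hy =>
    simp only [map_add]
    exact ⟨Submodule.add_mem _ hx.1 hy.1, Submodule.add_mem _ hx.2.1 hy.2.1,
      Submodule.add_mem _ hx.2.2 hy.2.2⟩
  | smul a x _ hx =>
    simp only [map_smul]
    exact ⟨Submodule.smul_mem _ _ hx.1, Submodule.smul_mem _ _ hx.2.1,
      Submodule.smul_mem _ _ hx.2.2⟩

/-- The parameters `z q^i` of the nonzero vectors of the ladder give distinct eigenvalues. -/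
def NonResonant (s : ℂ) (X₁ X₂ : Module.End ℂ V) (z : ℂ) (u : V) : Prop :=
  ∀ i l, i < l → climb s X₁ X₂ z u l ≠ 0 → z ^ 2 * (s ^ 2) ^ (i + l) ≠ 1

theorem climb_linearIndependent (hs : Generic s) (h : ∀ v, RelationsAt s A₃ X₁ X₂ X₃ v) {z : ℂ}
    {u : V} (hz : z ≠ 0) (hu : X₃ u = spec s z • u) (hres : NonResonant s X₁ X₂ z u) {M : ℕ}
    (hM : ∀ i < M, climb s X₁ X₂ z u i ≠ 0) :
    LinearIndependent ℂ fun i : Fin M => climb s X₁ X₂ z u i := by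
  have h0 := hs.ne_zero
  refine Module.End.eigenvectors_linearIndependent' X₃
    (fun i : Fin M => spec s (z * (s ^ 2) ^ (i : ℕ))) ?_ _ fun i => ?_
  · have key : ∀ i l : ℕ, i < l → l < M → spec s (z * (s ^ 2) ^ i) ≠ spec s (z * (s ^ 2) ^ l) := by
      intro i l hil hl e
      rcases (spec_eq_spec_iff hs (by positivity) (by positivity)).1 e with e | e
      · have e := mul_left_cancel₀ hz e
        rw [← pow_mul, ← pow_mul, ← zpow_natCast, ← zpow_natCast] at e
        have := hs.zpow_injective e
        omega
      · apply hres i l hil (hM l hl)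
        rw [← e]
        ring
    intro i l e
    rcases lt_trichotomy (i : ℕ) l with hil | hil | hil
    · exact (key i l hil l.2 e).elim
    · exact Fin.ext hil
    · exact (key l i hil i.2 e.symm).elim
  · exact ⟨Module.End.mem_eigenspace_iff.2 (climb_eigen hs h hz hu i), hM i i.2⟩

/-- The eigenvalues `±2 / (q - q⁻¹)` do not occur. -/
def Avoids (s : ℂ) (X₃ : Module.End ℂ V) : Prop :=
  ∀ (v : V) (y : ℂ), y ^ 2 = 1 → X₃ v = spec s y • v → v = 0

/-- Only the trivial subspaces are invariant under the three operators. -/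
def Irreducible (X₁ X₂ X₃ : Module.End ℂ V) : Prop :=
  ∀ W : Submodule ℂ V, (∀ w ∈ W, X₁ w ∈ W ∧ X₂ w ∈ W ∧ X₃ w ∈ W) → W = ⊥ ∨ W = ⊤

theorem exists_climb_eq_zero (hs : Generic s) (h : ∀ v, RelationsAt s A₃ X₁ X₂ X₃ v) {z : ℂ}
    {u : V} (hz : z ≠ 0) (hu : X₃ u = spec s z • u) (hres : NonResonant s X₁ X₂ z u)
    [FiniteDimensional ℂ V] : ∃ M, climb s X₁ X₂ z u M = 0 := by
  by_contra! hne
  have := (climb_linearIndependent hs h hz hu hres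
    (M := Module.finrank ℂ V + 1) fun i _ => hne i).fintype_card_le_finrank
  rw [Fintype.card_fin] at this
  omega

variable {N : ℕ}

/-- Until it terminates the ladder is independent and spans an invariant subspace, so it has exactly
`N + 1` vectors. Lowering the zero vector past the top gives the formula for `t ^ 2`. If an
intermediate lowering coefficient vanished, the part of the ladder above it would be invariant and
too small. -/
theorem climb_irreducible (hs : Generic s) (h : ∀ v, RelationsAt s A₃ X₁ X₂ X₃ v)
    (hN : Module.finrank ℂ V = N + 1) (hirr : Irreducible X₁ X₂ X₃) (hav : Avoids s X₃)
    {z t : ℂ} {u : V} (hu : IsBottom s X₁ X₂ X₃ z t u) (hu0 : u ≠ 0)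
    (hres : NonResonant s X₁ X₂ z u) :
    climb s X₁ X₂ z u (N + 1) = 0 ∧ (∀ i ≤ N, climb s X₁ X₂ z u i ≠ 0) ∧
      t ^ 2 = potential s A₃ z⁻¹ - potential s A₃ (z * (s ^ 2) ^ N) ∧
      ∀ i < N, potential s A₃ (z * (s ^ 2) ^ i) ≠ potential s A₃ (z * (s ^ 2) ^ N) := by
  classical
  have h0 := hs.ne_zero
  have hz := hu.param_ne_zero
  have : FiniteDimensional ℂ V := FiniteDimensional.of_finrank_pos (by omega)
  have hex := exists_climb_eq_zero hs h hz hu.eigen hres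
  obtain ⟨M, hM0, hM⟩ : ∃ M, climb s X₁ X₂ z u M = 0 ∧ ∀ i < M, climb s X₁ X₂ z u i ≠ 0 :=
    ⟨Nat.find hex, Nat.find_spec hex, fun i hi => Nat.find_min hex hi⟩
  have hMpos : 0 < M := by
    rcases Nat.eq_zero_or_pos M with rfl | h
    · exact (hu0 hM0).elim
    · exact h
  have hind := climb_linearIndependent hs h hz hu.eigen hres hM
  -- an upper part of the ladder that is closed under lowering is everything
  have tail : ∀ m < M, shiftOp s X₁ X₂ (z * (s ^ 2) ^ m)⁻¹ (climb s X₁ X₂ z u m) ∈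
      Submodule.span ℂ (Set.range fun i : Fin (M - m) => climb s X₁ X₂ z u (m + i)) →
      M - m = N + 1 := by
    intro m hm hmem
    set f := fun i : Fin (M - m) => climb s X₁ X₂ z u (m + i) with hf
    have hmemf : ∀ i, m ≤ i → climb s X₁ X₂ z u i ∈ Submodule.span ℂ (Set.range f) := by
      intro i hi
      by_cases hiM : i < M
      · refine Submodule.subset_span ⟨⟨i - m, by omega⟩, ?_⟩
        simp only [hf]
        congr 1
        omega
      · have : ∀ k, climb s X₁ X₂ z u (M + k) = 0 := by
          intro k
          induction k with
          | zero => exact hM0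
          | succ k ih => rw [← add_assoc, ← shiftOp_climb, ih, map_zero]
        obtain ⟨k, rfl⟩ := Nat.exists_eq_add_of_le (not_lt.1 hiM)
        rw [this]
        exact Submodule.zero_mem _
    have hinv := span_invariant (X₁ := X₁) (X₂ := X₂) (X₃ := X₃) h0 (S := Set.range f) (by
      rintro _ ⟨i, rfl⟩
      have hci := climb_eigen hs h hz hu.eigen (m + i)
      refine ⟨z * (s ^ 2) ^ (m + (i : ℕ)), by positivity, ?_, hci, ?_, ?_⟩
      · exact fun e => hM (m + i) (by omega) (hav _ _ e hci)
      · exact hmemf (m + i + 1) (by omega)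
      · obtain ⟨i, hi⟩ := i
        cases i with
        | zero => exact hmem
        | succ i =>
          simp only [hf]
          rw [← add_assoc, shiftOp_inv_climb_succ hs h hu (m + i)]
          exact Submodule.smul_mem _ _ (hmemf _ (by omega)))
    have hfi : LinearIndependent ℂ f :=
      hind.comp (fun i : Fin (M - m) => (⟨m + i, by omega⟩ : Fin M)) fun i l hil => by
        simp only [Fin.mk.injEq] at hil
        exact Fin.ext (by omega)
    rcases hirr _ hinv with hb | ht
    · have := hmemf m le_rfl
      rw [hb, Submodule.mem_bot] at this
      exact (hM m hm this).elim
    · have := finrank_span_eq_card hfi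
      rw [ht, finrank_top, hN, Fintype.card_fin] at this
      exact this.symm
  have hMN : M = N + 1 := by
    refine tail 0 hMpos ?_
    simp only [pow_zero, mul_one, climb]
    rw [hu.lower]
    exact Submodule.smul_mem _ _ (Submodule.subset_span ⟨⟨0, by omega⟩, rfl⟩)
  subst hMN
  have ht : t ^ 2 = potential s A₃ z⁻¹ - potential s A₃ (z * (s ^ 2) ^ N) := by
    have := shiftOp_inv_climb_succ hs h hu N
    rw [hM0, map_zero, eq_comm, smul_eq_zero] at this
    rcases this with this | this
    · linear_combination this
    · exact (hM N (by omega) this).elim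
  refine ⟨hM0, fun i hi => hM i (by omega), ht, fun i hi e => ?_⟩
  -- With the formula for `t ^ 2`, the coefficient of lowering rung `i + 1` is `P(z q^i) - P(z
  -- q^N)`, which the assumed equality makes zero.
  have := tail (i + 1) (by omega) (by
    rw [shiftOp_inv_climb_succ hs h hu i, ht, e]
    simp)
  omega

end Climb

/-! ### The dichotomy between ladders with and without a loop. -/

section Classification

variable {V : Type*} [AddCommGroup V] [Module ℂ V] {s A₃ : ℂ} {X₁ X₂ X₃ : Module.End ℂ V} {N : ℕ}

theorem climb_eq_zero_of_le {z : ℂ} {u : V} {i l : ℕ} (hil : i ≤ l)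
    (hi : climb s X₁ X₂ z u i = 0) : climb s X₁ X₂ z u l = 0 := by
  induction l, hil using Nat.le_induction with
  | base => exact hi
  | succ l _ ih => rw [← shiftOp_climb, ih, map_zero]

/-- Two representations with ladders of the same parameters and length are equivalent. -/
theorem exists_linearEquiv_of_climb {V' : Type*} [AddCommGroup V'] [Module ℂ V']
    {X₁' X₂' X₃' : Module.End ℂ V'} (hs : Generic s)
    (h : ∀ v, RelationsAt s A₃ X₁ X₂ X₃ v) (h' : ∀ v, RelationsAt s A₃ X₁' X₂' X₃' v)
    (hN : Module.finrank ℂ V = N + 1) (hN' : Module.finrank ℂ V' = N + 1)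
    (hav : Avoids s X₃) {z t : ℂ} {u : V} {u' : V'}
    (hu : IsBottom s X₁ X₂ X₃ z t u) (hu' : IsBottom s X₁' X₂' X₃' z t u')
    (hres : NonResonant s X₁ X₂ z u)
    (hne : ∀ i ≤ N, climb s X₁ X₂ z u i ≠ 0) (hne' : ∀ i ≤ N, climb s X₁' X₂' z u' i ≠ 0)
    (h0 : climb s X₁ X₂ z u (N + 1) = 0) (h0' : climb s X₁' X₂' z u' (N + 1) = 0) :
    ∃ φ : V ≃ₗ[ℂ] V', ∀ v, φ (X₁ v) = X₁' (φ v) ∧ φ (X₂ v) = X₂' (φ v) ∧ φ (X₃ v) = X₃' (φ v) := by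
  have hs0 := hs.ne_zero
  have hz := hu.param_ne_zero
  have hres' : NonResonant s X₁' X₂' z u' := by
    intro i l hil hl
    refine hres i l hil (hne l ?_)
    by_contra hlN
    exact hl (climb_eq_zero_of_le (by omega) h0')
  let b := basisOfLinearIndependentOfCardEqFinrank (climb_linearIndependent hs h hz hu.eigen hres
    (M := N + 1) fun i hi => hne i (by omega)) (by rw [hN, Fintype.card_fin])
  let b' := basisOfLinearIndependentOfCardEqFinrank (climb_linearIndependent hs h' hz hu'.eigen hres'
    (M := N + 1) fun i hi => hne' i (by omega)) (by rw [hN', Fintype.card_fin])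
  let φ := b.equiv b' (Equiv.refl _)
  have hb : ∀ i : Fin (N + 1), b i = climb s X₁ X₂ z u i := fun i => by simp [b]
  have hb' : ∀ i : Fin (N + 1), b' i = climb s X₁' X₂' z u' i := fun i => by simp [b']
  have hφ : ∀ i ≤ N + 1, φ (climb s X₁ X₂ z u i) = climb s X₁' X₂' z u' i := by
    intro i hi
    rcases Nat.lt_or_ge i (N + 1) with hi | hi
    · have := b.equiv_apply (⟨i, hi⟩ : Fin (N + 1)) b' (Equiv.refl _)
      rw [hb, Equiv.refl_apply, hb'] at this
      exact this
    · obtain rfl : i = N + 1 := by omega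
      rw [h0, h0', map_zero]
  have hdown : ∀ i ≤ N, φ (shiftOp s X₁ X₂ (z * (s ^ 2) ^ i)⁻¹ (climb s X₁ X₂ z u i)) =
      shiftOp s X₁' X₂' (z * (s ^ 2) ^ i)⁻¹ (climb s X₁' X₂' z u' i) := by
    intro i hi
    cases i with
    | zero =>
      have := hφ 0 (by omega)
      simp only [pow_zero, mul_one, climb] at this ⊢
      -- The lowering action is the same scalar in both spaces: `t` at the bottom, and on higher
      -- rungs an expression in `t`, `z` and `A₃` alone.
      rw [hu.lower, hu'.lower, map_smul, this]
    | succ i =>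
      rw [shiftOp_inv_climb_succ hs h hu, shiftOp_inv_climb_succ hs h' hu', map_smul,
        hφ i (by omega)]
  have hup : ∀ i ≤ N, φ (shiftOp s X₁ X₂ (z * (s ^ 2) ^ i) (climb s X₁ X₂ z u i)) =
      shiftOp s X₁' X₂' (z * (s ^ 2) ^ i) (climb s X₁' X₂' z u' i) := fun i hi => by
    rw [shiftOp_climb, shiftOp_climb, hφ _ (by omega)]
  have hy0 : ∀ i, z * (s ^ 2) ^ i ≠ 0 := fun i => by positivity
  have hy2 : ∀ i ≤ N, (z * (s ^ 2) ^ i) ^ 2 ≠ 1 := fun i hi e =>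
    hne i hi (hav _ _ e (climb_eigen hs h hz hu.eigen i))
  refine ⟨φ, fun v => ⟨?_, ?_, ?_⟩⟩
  · suffices φ.toLinearMap ∘ₗ X₁ = X₁' ∘ₗ φ.toLinearMap from LinearMap.congr_fun this v
    refine b.ext fun i => ?_
    have hi : (i : ℕ) ≤ N := by omega
    simp only [LinearMap.comp_apply, LinearEquiv.coe_coe, hb, hφ i (by omega)]
    rw [first_eq_shiftOp (X₁ := X₁) (X₂ := X₂) hs0 (hy2 i hi),
      first_eq_shiftOp (X₁ := X₁') (X₂ := X₂') hs0 (hy2 i hi), map_smul, map_sub, map_smul,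
      hup i hi, hdown i hi]
  · suffices φ.toLinearMap ∘ₗ X₂ = X₂' ∘ₗ φ.toLinearMap from LinearMap.congr_fun this v
    refine b.ext fun i => ?_
    have hi : (i : ℕ) ≤ N := by omega
    simp only [LinearMap.comp_apply, LinearEquiv.coe_coe, hb, hφ i (by omega)]
    rw [second_eq_shiftOp (X₁ := X₁) (X₂ := X₂) hs0 (hy0 i) (hy2 i hi),
      second_eq_shiftOp (X₁ := X₁') (X₂ := X₂') hs0 (hy0 i) (hy2 i hi), map_smul, map_sub,
      hup i hi, hdown i hi]
  · suffices φ.toLinearMap ∘ₗ X₃ = X₃' ∘ₗ φ.toLinearMap from LinearMap.congr_fun this v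
    refine b.ext fun i => ?_
    simp only [LinearMap.comp_apply, LinearEquiv.coe_coe, hb, hφ i (by omega)]
    rw [climb_eigen hs h hz hu.eigen, climb_eigen hs h' hz hu'.eigen, map_smul, hφ i (by omega)]

/-- No eigenvalue of `I₃` has parameter `±s`. -/
def AvoidsLoop (s : ℂ) (X₃ : Module.End ℂ V) : Prop :=
  ∀ (v : V) (y : ℂ), y ^ 2 = s ^ 2 → X₃ v = spec s y • v → v = 0

/-- For `z² = q` the operator with parameter `z⁻¹` leads to the parameter `q z⁻¹ = z`, so it
preserves the eigenspace and has an eigenvector there. -/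
theorem exists_isBottom_of_loop [FiniteDimensional ℂ V] (hs : Generic s)
    (h : ∀ v, RelationsAt s A₃ X₁ X₂ X₃ v) {v : V} {z : ℂ} (hv0 : v ≠ 0) (hz : z ^ 2 = s ^ 2)
    (hv : X₃ v = spec s z • v) : ∃ t u, u ≠ 0 ∧ IsBottom s X₁ X₂ X₃ z t u := by
  have h0 := hs.ne_zero
  have hz0 : z ≠ 0 := by
    rintro rfl
    exact pow_ne_zero 2 h0 (by rw [← hz]; norm_num)
  let E := Module.End.eigenspace X₃ (spec s z)
  have hmaps : ∀ w ∈ E, shiftOp s X₁ X₂ z⁻¹ w ∈ E := by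
    intro w hw
    have hw : X₃ w = spec s z⁻¹ • w := by
      rw [spec_inv]
      exact Module.End.mem_eigenspace_iff.1 hw
    have := (h w).apply_shiftOp hs (inv_ne_zero hz0) hw
    rw [← hz, show z ^ 2 * z⁻¹ = z by field_simp] at this
    exact Module.End.mem_eigenspace_iff.2 this
  have : Nontrivial E := ⟨⟨⟨v, Module.End.mem_eigenspace_iff.2 hv⟩, 0, fun e => hv0 (by simpa using e)⟩⟩
  obtain ⟨t, ht⟩ := Module.End.exists_eigenvalue ((shiftOp s X₁ X₂ z⁻¹).restrict hmaps)
  obtain ⟨u, hu⟩ := ht.exists_hasEigenvector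
  refine ⟨t, u, fun e => hu.2 (by simpa using e), hz0, Module.End.mem_eigenspace_iff.1 u.2, ?_,
    Or.inr hz⟩
  exact congrArg Subtype.val hu.apply_eq_smul

theorem nonResonant_of_loop (hs : Generic s) {z : ℂ} (hz : z ^ 2 = s ^ 2) (u : V) :
    NonResonant s X₁ X₂ z u := by
  intro i l _ _ e
  rw [hz, ← pow_mul, ← pow_add] at e
  exact hs.zpow_ne_one ((2 + 2 * (i + l) : ℕ) : ℤ) (by omega) (by exact_mod_cast e)

/-- Two rungs with inverse parameters are placed symmetrically. If `i + l` is even, the rung in the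
middle has parameter `±1`; if it is odd, the rung just below the centre has parameter `±s⁻¹`. Both
are ruled out, so the ladder has already ended there. -/
theorem nonResonant_of_avoids (hs : Generic s) (h : ∀ v, RelationsAt s A₃ X₁ X₂ X₃ v)
    (hav : Avoids s X₃) (hav' : AvoidsLoop s X₃) {z : ℂ} {u : V} (hz : z ≠ 0)
    (hu : X₃ u = spec s z • u) : NonResonant s X₁ X₂ z u := by
  have h0 := hs.ne_zero
  intro i l hil hl e
  have he := climb_eigen hs h hz hu
  rcases Nat.even_or_odd' (i + l) with ⟨m, hm | hm⟩
  · refine hl (climb_eq_zero_of_le (i := m) (by omega) (hav _ (z * (s ^ 2) ^ m) ?_ (he m)))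
    rw [← e, hm]
    ring
  · refine hl (climb_eq_zero_of_le (i := m) (by omega) (hav' _ (z * (s ^ 2) ^ m)⁻¹ ?_ ?_))
    · rw [inv_pow]
      refine inv_eq_of_mul_eq_one_left ?_
      rw [← e, hm]
      ring
    · rw [spec_inv]
      exact he m

theorem exists_isBottom_of_avoids [FiniteDimensional ℂ V] [Nontrivial V] (hs : Generic s)
    (h : ∀ v, RelationsAt s A₃ X₁ X₂ X₃ v) (hav : Avoids s X₃) (hav' : AvoidsLoop s X₃) :
    ∃ z u, u ≠ 0 ∧ IsBottom s X₁ X₂ X₃ z 0 u := by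
  classical
  have h0 := hs.ne_zero
  obtain ⟨μ, hμ⟩ := Module.End.exists_eigenvalue X₃
  obtain ⟨v, hv⟩ := hμ.exists_hasEigenvector
  obtain ⟨y, hy, rfl⟩ := exists_spec_eq hs μ
  have hv1 := hv.apply_eq_smul
  have hex := exists_climb_eq_zero hs h hy hv1 (nonResonant_of_avoids hs h hav hav' hy hv1)
  obtain ⟨M, hM0, hM⟩ : ∃ M, climb s X₁ X₂ y v M = 0 ∧ ∀ i < M, climb s X₁ X₂ y v i ≠ 0 :=
    ⟨Nat.find hex, Nat.find_spec hex, fun i hi => Nat.find_min hex hi⟩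
  cases M with
  | zero => exact (hv.2 hM0).elim
  | succ M =>
    -- The last nonzero vector of the ladder, taken with the inverse parameter, is a bottom: raising
    -- and lowering exchange roles.
    refine ⟨(y * (s ^ 2) ^ M)⁻¹, climb s X₁ X₂ y v M, hM M (by omega), ?_, ?_, ?_, Or.inl rfl⟩
    · positivity
    · rw [spec_inv]
      exact climb_eigen hs h hy hv1 M
    · rw [inv_inv, shiftOp_climb, hM0, zero_smul]

/-- Equation for `w = q^{N/2} z`, where `z` is the parameter of the bottom of a ladder without
loop. -/
def LadderEquation (s A₃ : ℂ) (N : ℕ) (w : ℂ) : Prop :=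
  (s ^ (N + 1 : ℤ) + s ^ (-(N + 1) : ℤ)) * (w + w⁻¹) =
    -(A₃ * (s + s⁻¹) * (s ^ 2 - (s ^ 2)⁻¹))

theorem LadderEquation.eq_or (hs : Generic s) {w w' : ℂ} (hw0 : w ≠ 0) (hw0' : w' ≠ 0)
    (hw : LadderEquation s A₃ N w) (hw' : LadderEquation s A₃ N w') : w = w' ∨ w * w' = 1 := by
  have := mul_left_cancel₀ (hs.zpow_add_zpow_neg_ne_zero (N + 1)) (hw.trans hw'.symm)
  refine (spec_eq_spec_iff hs hw0 hw0').1 ?_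
  rw [spec, spec, this]

/-- Of the two linear factors of the potential difference, the first is nonzero because `z² q^N ≠ 1`
and `q^(N+1) ≠ 1`. The second vanishes exactly when the equation for `w` holds. -/
theorem potential_eq_iff_ladderEquation (hs : Generic s) {z : ℂ} (hz : z ≠ 0)
    (hz1 : z ^ 2 * (s ^ 2) ^ N ≠ 1) :
    potential s A₃ z⁻¹ = potential s A₃ (z * (s ^ 2) ^ N) ↔ LadderEquation s A₃ N (z * s ^ N) := by
  have h0 := hs.ne_zero
  have hk := hs.sub_inv_ne_zero
  have hz1' : z ^ 2 * (s ^ 2) ^ N - 1 ≠ 0 := sub_ne_zero.2 hz1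
  have hs1 : s ^ (N + 1) * s ^ (N + 1) - 1 ≠ 0 := by
    refine sub_ne_zero.2 fun e => ?_
    rw [← pow_add] at e
    exact hs.zpow_ne_one ((N + 1 + (N + 1) : ℕ) : ℤ) (by omega) (by exact_mod_cast e)
  rw [← sub_eq_zero, potential_sub, LadderEquation, ← sub_eq_zero (b := -(A₃ * _ * _))]
  have e1 : s * z⁻¹ + (s * z⁻¹)⁻¹ - (s * (z * (s ^ 2) ^ N) + (s * (z * (s ^ 2) ^ N))⁻¹) =
      -(z ^ 2 * (s ^ 2) ^ N - 1) * (s ^ (N + 1) * s ^ (N + 1) - 1) / (s * z * (s ^ 2) ^ N) := by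
    field_simp
    ring
  have e2 : s * z⁻¹ + (s * z⁻¹)⁻¹ + (s * (z * (s ^ 2) ^ N) + (s * (z * (s ^ 2) ^ N))⁻¹) =
      (s ^ (N + 1 : ℤ) + s ^ (-(N + 1) : ℤ)) * (z * s ^ N + (z * s ^ N)⁻¹) := by
    rw [zpow_neg, show (N + 1 : ℤ) = ((N + 1 : ℕ) : ℤ) by push_cast; ring, zpow_natCast]
    field_simp
    ring
  rw [e1, e2, sub_neg_eq_add, div_eq_zero_iff, neg_eq_zero, mul_eq_zero, or_iff_left (by positivity),
    or_iff_right]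
  exact div_ne_zero (mul_ne_zero (neg_ne_zero.2 hz1') hs1) (by positivity)

/-- An irreducible representation without loops has a ladder starting at any parameter allowed
by the equation. -/
theorem exists_isBottom_of_ladderEquation (hs : Generic s) (h : ∀ v, RelationsAt s A₃ X₁ X₂ X₃ v)
    (hN : Module.finrank ℂ V = N + 1) (hirr : Irreducible X₁ X₂ X₃) (hav : Avoids s X₃)
    (hav' : AvoidsLoop s X₃) :
    ∃ w, w ≠ 0 ∧ LadderEquation s A₃ N w ∧ ∀ z, z ≠ 0 → LadderEquation s A₃ N (z * s ^ N) →
      ∃ u, u ≠ 0 ∧ IsBottom s X₁ X₂ X₃ z 0 u := by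
  have h0 := hs.ne_zero
  have : FiniteDimensional ℂ V := FiniteDimensional.of_finrank_pos (by omega)
  have : Nontrivial V := Module.nontrivial_of_finrank_pos (R := ℂ) (by omega)
  obtain ⟨z, u, hu0, hu⟩ := exists_isBottom_of_avoids hs h hav hav'
  have hz := hu.param_ne_zero
  have hres := nonResonant_of_avoids hs h hav hav' hz hu.eigen
  obtain ⟨hc0, hc, ht, -⟩ := climb_irreducible hs h hN hirr hav hu hu0 hres
  have hz1 : z ^ 2 * (s ^ 2) ^ N ≠ 1 := by
    rcases Nat.eq_zero_or_pos N with rfl | hNpos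
    · exact fun e => hu0 (hav u z (by simpa using e) hu.eigen)
    · simpa using hres 0 N hNpos (hc N le_rfl)
  have hw : LadderEquation s A₃ N (z * s ^ N) :=
    (potential_eq_iff_ladderEquation hs hz hz1).1 (by linear_combination -ht)
  refine ⟨z * s ^ N, by positivity, hw, fun z' hz' hw' => ?_⟩
  rcases hw.eq_or hs (by positivity) (by positivity) hw' with e | e
  · rw [← mul_right_cancel₀ (pow_ne_zero N h0) e]
    exact ⟨u, hu0, hu⟩
  · have e : z' = (z * (s ^ 2) ^ N)⁻¹ := by
      refine eq_inv_of_mul_eq_one_left ?_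
      rw [← e]
      ring
    -- The inverse solution `w⁻¹` belongs to the same ladder read from its top.
    refine ⟨climb s X₁ X₂ z u N, hc N le_rfl, hz', ?_, ?_, Or.inl rfl⟩
    · rw [e, spec_inv]
      exact climb_eigen hs h hz hu.eigen N
    · rw [e, inv_inv, shiftOp_climb, hc0, zero_smul]

end Classification

/-- Without a loop there would be a ladder starting at `ε s^(k - 2N)`, whose parameters are `ε s^(k
- 2N + 2i)` for `0 ≤ i ≤ N`. For `-1 ≤ k ≤ 2N + 1` one of these is `±1`, `±s` or `±s⁻¹`. -/
theorem not_avoidsLoop_of_excluded {V : Type*} [AddCommGroup V] [Module ℂ V] {s A₃ : ℂ}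
    {X₁ X₂ X₃ : Module.End ℂ V} {N : ℕ} (hs : Generic s) (h : ∀ v, RelationsAt s A₃ X₁ X₂ X₃ v)
    (hN : Module.finrank ℂ V = N + 1) (hirr : Irreducible X₁ X₂ X₃) (hav : Avoids s X₃) {k : ℤ}
    {ε : ℂ} (hε : ε ^ 2 = 1) (hk : -1 ≤ k) (hk' : k ≤ 2 * N + 1)
    (hw : LadderEquation s A₃ N (ε * s ^ (k - N))) : ¬ AvoidsLoop s X₃ := by
  intro hav'
  have h0 := hs.ne_zero
  have hε0 : ε ≠ 0 := by
    rintro rfl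
    norm_num at hε
  obtain ⟨-, -, -, H⟩ := exists_isBottom_of_ladderEquation hs h hN hirr hav hav'
  obtain ⟨u, hu0, hu⟩ := H (ε * s ^ (k - 2 * N)) (mul_ne_zero hε0 (zpow_ne_zero _ h0)) (by
    rw [mul_assoc, ← zpow_natCast, ← zpow_add₀ h0]
    convert hw using 3
    ring)
  have hz := hu.param_ne_zero
  obtain ⟨-, hc, -, -⟩ := climb_irreducible hs h hN hirr hav hu hu0
    (nonResonant_of_avoids hs h hav hav' hz hu.eigen)
  have he := climb_eigen hs h hz hu.eigen
  have hp : ∀ i : ℕ, ε * s ^ (k - 2 * N) * (s ^ 2) ^ i = ε * s ^ (k - 2 * N + 2 * i) := fun i => by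
    rw [mul_assoc, ← pow_mul, ← zpow_natCast, ← zpow_add₀ h0]
    push_cast
    rfl
  rcases Int.even_or_odd' k with ⟨m, hm | hm⟩
  · obtain ⟨i, hi⟩ := Int.eq_ofNat_of_zero_le (show 0 ≤ (N : ℤ) - m by omega)
    refine hc i (by omega) (hav _ _ ?_ (he i))
    rw [hp, show k - 2 * N + 2 * i = 0 by omega, zpow_zero, mul_one, hε]
  · by_cases hmN : m = N
    · refine hc 0 (by omega) (hav' _ _ ?_ (he 0))
      rw [hp, show k - 2 * N + 2 * (0 : ℕ) = 1 by push_cast; omega, zpow_one, mul_pow, hε, one_mul]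
    · obtain ⟨i, hi⟩ := Int.eq_ofNat_of_zero_le (show 0 ≤ (N : ℤ) - m - 1 by omega)
      refine hc i (by omega) (hav' _ (ε * s ^ (k - 2 * N) * (s ^ 2) ^ i)⁻¹ ?_ ?_)
      · rw [hp, show k - 2 * N + 2 * i = -1 by omega, zpow_neg_one, mul_inv, inv_inv, mul_pow,
          inv_pow, hε, inv_one, one_mul]
      · rw [spec_inv]
        exact he i

/-! ### Tridiagonal matrices that form a ladder. -/

/-- The vector `v_k`, which is zero for `k > N`. -/
def stdVec (N k : ℕ) : Fin (N + 1) → ℂ := fun i => if (i : ℕ) = k then 1 else 0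

theorem stdVec_ne_zero {N k : ℕ} (hk : k ≤ N) : stdVec N k ≠ 0 := fun h => by
  simpa [stdVec] using congrFun h ⟨k, by omega⟩

theorem stdVec_eq_single {N : ℕ} (k : Fin (N + 1)) : stdVec N k = Pi.single k 1 := by
  ext i
  simp [stdVec, Pi.single_apply, Fin.ext_iff]

theorem toLin'_stdVec {N k : ℕ} (hk : k ≤ N) (M : Matrix (Fin (N + 1)) (Fin (N + 1)) ℂ)
    (i : Fin (N + 1)) : Matrix.toLin' M (stdVec N k) i = M i ⟨k, by omega⟩ := by
  rw [show stdVec N k = Pi.single ⟨k, by omega⟩ 1 from stdVec_eq_single ⟨k, by omega⟩,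
    Matrix.toLin'_apply, Matrix.mulVec_single_one]
  rfl

theorem shiftOp_shiftMatrix (s y : ℂ) (N : ℕ) (a : ℂ) (d u d' u' : ℤ → ℂ) :
    shiftOp s (Matrix.toLin' (shiftMatrix N a d u)) (Matrix.toLin' (shiftMatrix N a d' u')) y =
      Matrix.toLin' (shiftMatrix N a (fun j => d j - s⁻¹ * y * d' j)
        fun j => u j - s⁻¹ * y * u' j) := by
  rw [shiftOp, ← map_smul, ← map_sub]
  congr 1
  ext i j
  simp only [shiftMatrix, Matrix.of_apply, Matrix.sub_apply, Matrix.smul_apply, smul_eq_mul]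
  split_ifs <;> ring

/-- The corner entry of the matrix is `a` times `u N`, so for `k + 1 = N` it disappears together
with `u`. -/
theorem shiftMatrix_zero_up {N k : ℕ} (hk : k + 1 ≤ N) (a : ℂ) (d u : ℤ → ℂ)
    (hu : u (k + 1 : ℕ) = 0) :
    Matrix.toLin' (shiftMatrix N a d u) (stdVec N (k + 1)) = d (k + 1 : ℕ) • stdVec N k := by
  ext i
  rw [toLin'_stdVec hk]
  simp only [shiftMatrix, Matrix.of_apply, stdVec, Pi.smul_apply, smul_eq_mul]
  rw [hu]
  by_cases hkN : k + 1 = N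
  · subst hkN
    rw [hu]
    simp
  · simp [hkN]

theorem shiftMatrix_zero_up_zero {N : ℕ} (a : ℂ) (d u : ℤ → ℂ) (hu : u (0 : ℕ) = 0) :
    Matrix.toLin' (shiftMatrix N a d u) (stdVec N 0) = 0 := by
  ext i
  rw [toLin'_stdVec (Nat.zero_le _)]
  simp only [shiftMatrix, Matrix.of_apply, Pi.zero_apply]
  rw [hu]
  by_cases hkN : 0 = N
  · subst hkN
    simp [show u 0 = 0 from hu]
  · simp [hkN]

theorem shiftMatrix_zero_down {N k : ℕ} (hk : k < N) (a : ℂ) (d u : ℤ → ℂ)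
    (hd : d (k : ℕ) = 0) :
    Matrix.toLin' (shiftMatrix N a d u) (stdVec N k) = u (k : ℕ) • stdVec N (k + 1) := by
  ext i
  rw [toLin'_stdVec hk.le]
  simp only [shiftMatrix, Matrix.of_apply, stdVec, Pi.smul_apply, smul_eq_mul]
  rw [hd]
  simp [hk.ne]

theorem shiftMatrix_zero_down_last {N : ℕ} (a : ℂ) (d u : ℤ → ℂ) (hd : d (N : ℕ) = 0) :
    Matrix.toLin' (shiftMatrix N a d u) (stdVec N N) = (a * u N) • stdVec N N := by
  ext i
  rw [toLin'_stdVec le_rfl]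
  have : (i : ℕ) ≠ N + 1 := by omega
  simp [shiftMatrix, stdVec, hd, this]

/-- Conditions under which tridiagonal matrices form a ladder; `v_j` has parameter
`z q^{N-j}`. -/
structure LadderData (s A₃ : ℂ) (N : ℕ) (z t a : ℂ) (d u d' u' : ℤ → ℂ)
    (lam : Fin (N + 1) → ℂ) : Prop where
  param_ne_zero : z ≠ 0
  eigen : ∀ (i : ℕ) (j : Fin (N + 1)), i + j = N → lam j = spec s (z * (s ^ 2) ^ i)
  sq_ne_one : ∀ i ≤ N, (z * (s ^ 2) ^ i) ^ 2 ≠ 1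
  distinct : ∀ i l, i < l → l ≤ N → z ^ 2 * (s ^ 2) ^ (i + l) ≠ 1
  down : ∀ i j : ℕ, i + j = N → d' j = s * (z * (s ^ 2) ^ i) * d j
  up : ∀ i j : ℕ, i + j = N → u' j = s * (z * (s ^ 2) ^ i)⁻¹ * u j
  up_ne_zero : ∀ j : ℕ, j ≤ N → u j ≠ 0
  prod : ∀ i j : ℕ, i + 1 + j = N →
    d (j + 1 : ℕ) * (1 - (z * (s ^ 2) ^ i) ^ 2) *
        (u j * (1 - ((z * (s ^ 2) ^ (i + 1)) ^ 2)⁻¹)) =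
      potential s A₃ (z * (s ^ 2) ^ i) - potential s A₃ (z * (s ^ 2) ^ N)
  loop_eq : a * u N * (1 - (z ^ 2)⁻¹) = t
  loop : t = 0 ∨ z ^ 2 = s ^ 2
  loop_sq : t ^ 2 = potential s A₃ z⁻¹ - potential s A₃ (z * (s ^ 2) ^ N)

namespace LadderData

variable {s A₃ : ℂ} {N : ℕ} {z t a : ℂ} {d u d' u' : ℤ → ℂ} {lam : Fin (N + 1) → ℂ}

local notation "Y₁" => Matrix.toLin' (shiftMatrix N a d u)
local notation "Y₂" => Matrix.toLin' (shiftMatrix N a d' u')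
local notation "Y₃" => Matrix.toLin' (Matrix.diagonal lam)

theorem diagonal_stdVec (L : LadderData s A₃ N z t a d u d' u' lam) {i j : ℕ} (hij : i + j = N) :
    Y₃ (stdVec N j) = spec s (z * (s ^ 2) ^ i) • stdVec N j := by
  ext k
  rw [toLin'_stdVec (by omega), Matrix.diagonal_apply]
  simp only [stdVec, Pi.smul_apply, smul_eq_mul, Fin.ext_iff]
  split_ifs with h
  · rw [mul_one, L.eigen i k (by omega)]
  · simp

/-- The ratios `u' / u` and `d' / d` in `LadderData` are such that the raising operator loses its
`v_{j+1}` component and the lowering operator its `v_{j-1}` component. Climbing the ladder lowers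
the index `j`. -/
theorem raise (hs : Generic s) (L : LadderData s A₃ N z t a d u d' u' lam) {i j : ℕ}
    (hij : i + 1 + j = N) : shiftOp s Y₁ Y₂ (z * (s ^ 2) ^ i) (stdVec N (j + 1)) =
      (d (j + 1 : ℕ) * (1 - (z * (s ^ 2) ^ i) ^ 2)) • stdVec N j := by
  have h0 := hs.ne_zero
  have hz := L.param_ne_zero
  rw [shiftOp_shiftMatrix, shiftMatrix_zero_up (by omega)]
  · rw [L.down i (j + 1) (by omega)]
    congr 1
    field_simp
  · rw [L.up i (j + 1) (by omega)]
    field_simp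
    ring

theorem raise_top (hs : Generic s) (L : LadderData s A₃ N z t a d u d' u' lam) :
    shiftOp s Y₁ Y₂ (z * (s ^ 2) ^ N) (stdVec N 0) = 0 := by
  have h0 := hs.ne_zero
  have hz := L.param_ne_zero
  rw [shiftOp_shiftMatrix, shiftMatrix_zero_up_zero]
  rw [L.up N 0 (by omega)]
  field_simp
  ring

theorem lower (hs : Generic s) (L : LadderData s A₃ N z t a d u d' u' lam) {i j : ℕ}
    (hij : i + 1 + j = N) : shiftOp s Y₁ Y₂ (z * (s ^ 2) ^ (i + 1))⁻¹ (stdVec N j) =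
      (u j * (1 - ((z * (s ^ 2) ^ (i + 1)) ^ 2)⁻¹)) • stdVec N (j + 1) := by
  have h0 := hs.ne_zero
  have hz := L.param_ne_zero
  rw [shiftOp_shiftMatrix, shiftMatrix_zero_down (by omega)]
  · rw [L.up (i + 1) j (by omega)]
    congr 1
    field_simp
  · rw [L.down (i + 1) j (by omega)]
    field_simp
    ring

theorem isBottom (hs : Generic s) (L : LadderData s A₃ N z t a d u d' u' lam) :
    IsBottom s Y₁ Y₂ Y₃ z t (stdVec N N) := by
  have h0 := hs.ne_zero
  have hz := L.param_ne_zero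
  refine ⟨hz, by simpa using L.diagonal_stdVec (Nat.zero_add N), ?_, L.loop⟩
  have hd := L.down 0 N (by omega)
  have hu := L.up 0 N (by omega)
  rw [pow_zero, mul_one] at hd hu
  rw [shiftOp_shiftMatrix, shiftMatrix_zero_down_last]
  · rw [hu, ← L.loop_eq]
    congr 1
    field_simp
  · rw [hd]
    field_simp
    ring

/-- Both products of ladder operators act on `v_j` by a potential minus the common constant `P(z
q^N)`. The constant drops out of the difference, and `relationsAt_of_ladder` applies. -/
theorem relationsAt_stdVec (hs : Generic s) (L : LadderData s A₃ N z t a d u d' u' lam) {i j : ℕ}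
    (hij : i + j = N) : RelationsAt s A₃ Y₁ Y₂ Y₃ (stdVec N j) := by
  have h0 := hs.ne_zero
  have hz := L.param_ne_zero
  have hy : z * (s ^ 2) ^ i ≠ 0 := by positivity
  have e : s ^ 2 * (z * (s ^ 2) ^ i) = z * (s ^ 2) ^ (i + 1) := by ring
  have e' : ∀ i, z * (s ^ 2) ^ (i + 1) / s ^ 2 = z * (s ^ 2) ^ i := fun i => by
    field_simp
    exact pow_succ' _ _
  -- raising, followed by lowering
  obtain ⟨up1, up2⟩ : Y₃ (shiftOp s Y₁ Y₂ (z * (s ^ 2) ^ i) (stdVec N j)) =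
        spec s (z * (s ^ 2) ^ (i + 1)) • shiftOp s Y₁ Y₂ (z * (s ^ 2) ^ i) (stdVec N j) ∧
      shiftOp s Y₁ Y₂ (z * (s ^ 2) ^ (i + 1))⁻¹
          (shiftOp s Y₁ Y₂ (z * (s ^ 2) ^ i) (stdVec N j)) =
        (potential s A₃ (z * (s ^ 2) ^ i) - potential s A₃ (z * (s ^ 2) ^ N)) • stdVec N j := by
    cases j with
    | zero =>
      obtain rfl : i = N := by omega
      rw [L.raise_top hs]
      simp
    | succ j =>
      rw [L.raise hs (i := i) (j := j) (by omega), map_smul, map_smul,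
        L.diagonal_stdVec (i := i + 1) (by omega), L.lower hs (by omega)]
      exact ⟨smul_comm _ _ _, by rw [smul_smul, L.prod i j (by omega)]⟩
  -- lowering, followed by raising
  obtain ⟨down1, down2⟩ : Y₃ (shiftOp s Y₁ Y₂ (z * (s ^ 2) ^ i)⁻¹ (stdVec N j)) =
        spec s (z * (s ^ 2) ^ i / s ^ 2) • shiftOp s Y₁ Y₂ (z * (s ^ 2) ^ i)⁻¹ (stdVec N j) ∧
      shiftOp s Y₁ Y₂ (z * (s ^ 2) ^ i / s ^ 2)
          (shiftOp s Y₁ Y₂ (z * (s ^ 2) ^ i)⁻¹ (stdVec N j)) =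
        (potential s A₃ (z * (s ^ 2) ^ i)⁻¹ - potential s A₃ (z * (s ^ 2) ^ N)) • stdVec N j := by
    cases i with
    | zero =>
      obtain rfl : j = N := by omega
      have hb := L.isBottom hs
      rw [pow_zero, mul_one, hb.lower, map_smul, map_smul, hb.eigen, ← L.loop_sq]
      rcases L.loop with ht | ht
      · simp [ht]
      · have : z / s ^ 2 = z⁻¹ := by
          rw [← ht]
          field_simp
        rw [this, hb.lower, spec_inv, smul_smul, smul_smul, smul_smul, mul_comm, pow_two]
        exact ⟨rfl, rfl⟩
    | succ i =>
      rw [e', L.lower hs (i := i) (by omega), map_smul, map_smul,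
        L.diagonal_stdVec (i := i) (by omega), L.raise hs (by omega)]
      refine ⟨smul_comm _ _ _, ?_⟩
      rw [smul_smul, mul_comm, L.prod i j (by omega), show z * (s ^ 2) ^ (i + 1) =
        s ^ 2 * (z * (s ^ 2) ^ i) by ring, potential_inv _ _ _ h0]
  refine relationsAt_of_ladder hs hy (L.sq_ne_one i (by omega)) (L.diagonal_stdVec hij) ?_ down1 ?_
  · rw [e]
    exact up1
  · rw [e, up2, down2, ← sub_smul, sub_sub_sub_cancel_right]

theorem relationsAt (hs : Generic s) (L : LadderData s A₃ N z t a d u d' u' lam)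
    (v : Fin (N + 1) → ℂ) : RelationsAt s A₃ Y₁ Y₂ Y₃ v := by
  have key := fun j : Fin (N + 1) => L.relationsAt_stdVec hs (i := N - j) (j := j) (by omega)
  simp only [stdVec_eq_single] at key
  refine ⟨?_, ?_, ?_⟩
  · suffices s • (Y₁ ∘ₗ Y₂) - s⁻¹ • (Y₂ ∘ₗ Y₁) = Y₃ + A₃ • LinearMap.id from
      LinearMap.congr_fun this v
    refine (Pi.basisFun ℂ (Fin (N + 1))).ext fun j => ?_
    rw [Pi.basisFun_apply]
    exact (key j).rel₁
  · suffices s • (Y₂ ∘ₗ Y₃) - s⁻¹ • (Y₃ ∘ₗ Y₂) = Y₁ from LinearMap.congr_fun this v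
    refine (Pi.basisFun ℂ (Fin (N + 1))).ext fun j => ?_
    rw [Pi.basisFun_apply]
    exact (key j).rel₂
  · suffices s • (Y₃ ∘ₗ Y₁) - s⁻¹ • (Y₁ ∘ₗ Y₃) = Y₂ from LinearMap.congr_fun this v
    refine (Pi.basisFun ℂ (Fin (N + 1))).ext fun j => ?_
    rw [Pi.basisFun_apply]
    exact (key j).rel₃

theorem climb_eq (hs : Generic s) (L : LadderData s A₃ N z t a d u d' u' lam) {i j : ℕ}
    (hij : i + j = N) : ∃ c : ℂ, climb s Y₁ Y₂ z (stdVec N N) i = c • stdVec N j ∧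
      ((∀ l, l < i → d (N - l : ℕ) ≠ 0) → c ≠ 0) := by
  induction i generalizing j with
  | zero => exact ⟨1, by simp [climb, ← hij], fun _ => one_ne_zero⟩
  | succ i ih =>
    obtain ⟨c, hc, hc0⟩ := ih (j := j + 1) (by omega)
    rw [← shiftOp_climb, hc, map_smul, L.raise hs (by omega), smul_smul]
    refine ⟨_, rfl, fun hd => mul_ne_zero (hc0 fun l hl => hd l (by omega)) (mul_ne_zero ?_ ?_)⟩
    · have := hd i (by omega)
      rwa [show N - i = j + 1 by omega] at this
    · exact sub_ne_zero.2 (L.sq_ne_one i (by omega)).symm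

theorem climb_last (hs : Generic s) (L : LadderData s A₃ N z t a d u d' u' lam) :
    climb s Y₁ Y₂ z (stdVec N N) (N + 1) = 0 := by
  obtain ⟨c, hc, -⟩ := L.climb_eq hs (i := N) (j := 0) (by omega)
  rw [← shiftOp_climb, hc, map_smul, L.raise_top hs, smul_zero]

theorem climb_ne_zero (hs : Generic s) (L : LadderData s A₃ N z t a d u d' u' lam)
    (hd : ∀ j : ℕ, 1 ≤ j → j ≤ N → d j ≠ 0) {i : ℕ} (hi : i ≤ N) :
    climb s Y₁ Y₂ z (stdVec N N) i ≠ 0 := by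
  obtain ⟨c, hc, hc0⟩ := L.climb_eq hs (i := i) (j := N - i) (by omega)
  rw [hc]
  exact smul_ne_zero (hc0 fun l hl => hd _ (by omega) (by omega)) (stdVec_ne_zero (by omega))

theorem eq_spec_of_eigenvector (L : LadderData s A₃ N z t a d u d' u' lam) {v : Fin (N + 1) → ℂ}
    {μ : ℂ} (hv : Y₃ v = μ • v) {j : Fin (N + 1)} (hj : v j ≠ 0) {i : ℕ} (hij : i + j = N) :
    μ = spec s (z * (s ^ 2) ^ i) := by
  have := congrFun hv j
  rw [Matrix.toLin'_apply, Matrix.mulVec_diagonal, Pi.smul_apply, smul_eq_mul] at this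
  rw [← L.eigen i j hij, mul_right_cancel₀ hj this]

theorem avoids (hs : Generic s) (L : LadderData s A₃ N z t a d u d' u' lam) : Avoids s Y₃ := by
  have h0 := hs.ne_zero
  have hz := L.param_ne_zero
  intro v y hy hv
  by_contra hne
  obtain ⟨j, hj⟩ := Function.ne_iff.1 hne
  have hy0 : y ≠ 0 := by
    rintro rfl
    norm_num at hy
  rcases (spec_eq_spec_iff hs hy0 (by positivity)).1
    (L.eq_spec_of_eigenvector hv hj (i := N - j) (by omega)) with e | e
  · exact L.sq_ne_one (N - j) (by omega) (by rw [← e, hy])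
  · have e2 : (y * (z * (s ^ 2) ^ (N - (j : ℕ)))) ^ 2 = 1 := by rw [e, one_pow]
    rw [mul_pow, hy, one_mul] at e2
    exact L.sq_ne_one (N - j) (by omega) e2

/-- A vanishing `d j` makes a lowering coefficient vanish, contrary to `climb_irreducible`.
Conversely, since the eigenvalues of `I₃` are distinct, a nonzero invariant subspace contains some
`v_j`; the nonzero `u` lead from it down to `v_N` and the nonzero `d` from there to every basis
vector. -/
theorem irreducible_iff (hs : Generic s) (L : LadderData s A₃ N z t a d u d' u' lam) :
    Irreducible Y₁ Y₂ Y₃ ↔ ∀ j : ℕ, 1 ≤ j → j ≤ N → d j ≠ 0 := by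
  have h0 := hs.ne_zero
  have hz := L.param_ne_zero
  constructor
  · intro hirr j hj hjN hd
    have hB := L.isBottom hs
    have hu0 : stdVec N N ≠ 0 := stdVec_ne_zero le_rfl
    have hlast := L.climb_last hs
    have hres : NonResonant s Y₁ Y₂ z (stdVec N N) := by
      intro i l hil hl
      refine L.distinct i l hil ?_
      by_contra hlN
      exact hl (climb_eq_zero_of_le (by omega) hlast)
    obtain ⟨-, -, -, hP⟩ := climb_irreducible (N := N) hs (L.relationsAt hs) (by simp) hirr (L.avoids hs) hB
      hu0 hres
    obtain ⟨k, rfl⟩ : ∃ k, j = k + 1 := ⟨j - 1, by omega⟩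
    refine hP (N - (k + 1)) (by omega) (sub_eq_zero.1 ?_)
    rw [← L.prod (N - (k + 1)) k (by omega), hd, zero_mul, zero_mul]
  · intro hd W hW
    by_cases hb : W = ⊥
    · exact Or.inl hb
    refine Or.inr ?_
    have hstep : ∀ y, ∀ w ∈ W, shiftOp s Y₁ Y₂ y w ∈ W := fun y w hw =>
      W.sub_mem (hW w hw).1 (W.smul_mem _ (hW w hw).2.1)
    -- an eigenvector in `W` is a multiple of some `v_j`
    obtain ⟨j, hjN, hj⟩ : ∃ j ≤ N, stdVec N j ∈ W := by
      have : Nontrivial W := Submodule.nontrivial_iff_ne_bot.2 hb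
      obtain ⟨μ, hμ⟩ := Module.End.exists_eigenvalue (LinearMap.restrict Y₃ fun w hw => (hW w hw).2.2)
      obtain ⟨w, hw⟩ := hμ.exists_hasEigenvector
      have hw1 : Y₃ (w : Fin (N + 1) → ℂ) = μ • (w : Fin (N + 1) → ℂ) :=
        congrArg Subtype.val hw.apply_eq_smul
      have hw0 : (w : Fin (N + 1) → ℂ) ≠ 0 := fun e => hw.2 (by simpa using e)
      obtain ⟨j, hj⟩ := Function.ne_iff.1 hw0
      have hother : ∀ k, k ≠ j → (w : Fin (N + 1) → ℂ) k = 0 := by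
        intro k hk
        by_contra hk0
        have e := (L.eq_spec_of_eigenvector hw1 hj (i := N - j) (by omega)).symm.trans
          (L.eq_spec_of_eigenvector hw1 hk0 (i := N - k) (by omega))
        have hkj : (k : ℕ) ≠ j := fun h => hk (Fin.ext h)
        rcases (spec_eq_spec_iff hs (by positivity) (by positivity)).1 e with e | e
        · have e := mul_left_cancel₀ hz e
          rw [← pow_mul, ← pow_mul, ← zpow_natCast, ← zpow_natCast] at e
          have := hs.zpow_injective e
          omega
        · rcases lt_or_gt_of_ne hkj with h | h
          · refine L.distinct (N - j) (N - k) (by omega) (by omega) ?_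
            rw [← e]
            ring
          · refine L.distinct (N - k) (N - j) (by omega) (by omega) ?_
            rw [← e]
            ring
      refine ⟨j, by omega, ?_⟩
      have : stdVec N j = ((w : Fin (N + 1) → ℂ) j)⁻¹ • (w : Fin (N + 1) → ℂ) := by
        rw [stdVec_eq_single]
        ext k
        by_cases hk : k = j
        · subst hk
          simp [inv_mul_cancel₀ hj]
        · simp [hk, hother k hk]
      rw [this]
      exact W.smul_mem _ w.2
    have hlow : stdVec N N ∈ W := by
      have : ∀ k, j ≤ k → k ≤ N → stdVec N k ∈ W := by
        intro k hk
        induction k, hk using Nat.le_induction with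
        | base => exact fun _ => hj
        | succ k _ ih =>
          intro hkN
          have := hstep (z * (s ^ 2) ^ (N - (k + 1) + 1))⁻¹ _ (ih (by omega))
          rw [L.lower hs (by omega)] at this
          refine (W.smul_mem_iff (mul_ne_zero (L.up_ne_zero k (by omega)) ?_)).1 this
          have := L.sq_ne_one (N - (k + 1) + 1) (by omega)
          rw [sub_ne_zero, ne_comm]
          exact fun e => this (inv_eq_one.1 e)
      exact this N hjN le_rfl
    have hall : ∀ i j, i + j = N → stdVec N j ∈ W := by
      intro i
      induction i with
      | zero =>
        intro j hj
        obtain rfl : j = N := by omega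
        exact hlow
      | succ i ih =>
        intro j hij
        have := hstep (z * (s ^ 2) ^ i) _ (ih (j + 1) (by omega))
        rw [L.raise hs (by omega)] at this
        exact (W.smul_mem_iff (mul_ne_zero (hd _ (by omega) (by omega))
          (sub_ne_zero.2 (L.sq_ne_one i (by omega)).symm))).1 this
    rw [eq_top_iff, ← (Pi.basisFun ℂ (Fin (N + 1))).span_eq, Submodule.span_le]
    rintro _ ⟨j, rfl⟩
    rw [Pi.basisFun_apply, ← stdVec_eq_single]
    exact hall (N - j) j (by omega)

end LadderData

/-! ### The classical formulas form a ladder. -/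

/-- Every power of `s` in the formulas is rewritten as a monomial in `s ^ i`, `s ^ j` and `s`, so
that the coefficient identities become identities of rational functions. -/
theorem zpow_eq_of_exponent {s : ℂ} (h0 : s ≠ 0) (i j : ℕ) (a b c : ℤ) {m : ℤ}
    (hm : m = a * i + b * j + c) : s ^ m = (s ^ i) ^ a * (s ^ j) ^ b * s ^ c := by
  rw [hm, zpow_add₀ h0, zpow_add₀ h0, ← zpow_natCast s i, ← zpow_natCast s j, ← zpow_mul,
    ← zpow_mul, mul_comm a, mul_comm b]

theorem sq_zpow_eq_of_exponent {s : ℂ} (h0 : s ≠ 0) (i j : ℕ) (a b c : ℤ) {m : ℤ}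
    (hm : 2 * m = a * i + b * j + c) : (s ^ 2) ^ m = (s ^ i) ^ a * (s ^ j) ^ b * s ^ c := by
  rw [← zpow_eq_of_exponent h0 i j a b c hm, zpow_mul, zpow_ofNat]

theorem ladderEquation_classical {s A₃ x : ℂ} {N : ℕ} (hs : Generic s)
    (hx : IsClassicalParam (s ^ 2) s A₃ N x) :
    LadderEquation s A₃ N (-Complex.I * x * (s ^ N)⁻¹) := by
  have hk := hs.sub_inv_ne_zero
  obtain ⟨hx0, hx⟩ := hx
  rw [mul_div_assoc', div_eq_iff hk, zpow_neg s (N : ℤ), zpow_natCast] at hx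
  rw [LadderEquation, mul_inv, mul_inv, inv_inv, inv_neg, Complex.inv_I]
  linear_combination -Complex.I * hx + (s + s⁻¹) * A₃ * (s ^ 2 - (s ^ 2)⁻¹) * Complex.I_sq

section Coefficients

variable {s x y : ℂ} {j : ℕ}

/-- The hypothesis `x = i y q^j` says that `y` is the parameter of `v_j`. In terms of `y` the
coefficients of the formulas no longer involve `j` explicitly. -/
theorem inv_sq_mul_zpow (h0 : s ≠ 0) (hx : x = Complex.I * y * (s ^ 2) ^ j) :
    x ^ (-2 : ℤ) * (s ^ 2) ^ (2 * (j : ℤ)) = -(y ^ 2)⁻¹ := by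
  rw [sq_zpow_eq_of_exponent h0 j 0 4 0 0 (by ring), hx, pow_right_comm s 2 j]
  simp only [zpow_neg, zpow_ofNat, pow_zero, mul_pow, Complex.I_sq]
  field_simp

theorem mul_zpow_three (h0 : s ≠ 0) (hx : x = Complex.I * y * (s ^ 2) ^ j) :
    x * s ^ (3 - 2 * (j : ℤ)) = Complex.I * y * s ^ 3 := by
  rw [zpow_eq_of_exponent h0 j 0 (-2) 0 3 (by ring), hx, pow_right_comm s 2 j]
  simp only [zpow_neg, zpow_ofNat, pow_zero]
  field_simp

theorem inv_mul_zpow (h0 : s ≠ 0) (hx : x = Complex.I * y * (s ^ 2) ^ j) :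
    x⁻¹ * s ^ (2 * (j : ℤ) - 1) = -Complex.I * y⁻¹ * s⁻¹ := by
  rw [zpow_eq_of_exponent h0 j 0 2 0 (-1) (by ring), hx, pow_right_comm s 2 j, mul_inv, mul_inv,
    Complex.inv_I]
  simp only [zpow_neg, zpow_ofNat, pow_zero, pow_one]
  field_simp

theorem sq_mul_zpow (h0 : s ≠ 0) (hx : x = Complex.I * y * (s ^ 2) ^ j) :
    x ^ 2 * (s ^ 2) ^ (2 - 2 * (j : ℤ)) = -(y ^ 2 * s ^ 4) := by
  rw [sq_zpow_eq_of_exponent h0 j 0 (-4) 0 4 (by ring), hx, pow_right_comm s 2 j]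
  simp only [zpow_neg, zpow_ofNat, pow_zero, mul_pow, Complex.I_sq]
  field_simp

theorem classicalFactor_eq (h0 : s ≠ 0) (hy : y ≠ 0) {i N : ℕ} (hij : i + 1 + j = N)
    (hx : x = Complex.I * y * (s ^ 2) ^ (j + 1)) :
    classicalFactor (s ^ 2) N x (j + 1 : ℕ) =
      (1 - (s ^ j) ^ 2 * s ^ 2) * (1 - ((s ^ i) ^ 2 * s ^ 2)⁻¹) *
        (1 - (y ^ 2 * (s ^ j) ^ 2 * s ^ 4)⁻¹) * (1 - (s ^ i) ^ 2 * (y ^ 2)⁻¹) := by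
  have e1 : (s ^ 2) ^ ((j + 1 : ℕ) : ℤ) = (s ^ j) ^ 2 * s ^ 2 := by
    rw [sq_zpow_eq_of_exponent h0 i j 0 2 2 (by push_cast; ring)]
    simp
  have e2 : (s ^ 2) ^ (((j + 1 : ℕ) : ℤ) - N - 1) = ((s ^ i) ^ 2 * s ^ 2)⁻¹ := by
    rw [sq_zpow_eq_of_exponent h0 i j (-2) 0 (-2) (by rw [← hij]; push_cast; ring)]
    simp only [zpow_neg, zpow_ofNat, pow_zero]
    field_simp
  have e3 : (s ^ 2) ^ (((j + 1 : ℕ) : ℤ) - 1) = (s ^ j) ^ 2 := by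
    rw [sq_zpow_eq_of_exponent h0 i j 0 2 0 (by push_cast; ring)]
    simp
  have e4 : (s ^ 2) ^ (((j + 1 : ℕ) : ℤ) + N) = (s ^ i) ^ 2 * (s ^ j) ^ 4 * s ^ 4 := by
    rw [sq_zpow_eq_of_exponent h0 i j 2 4 4 (by rw [← hij]; push_cast; ring)]
    simp
  have e5 : x ^ (-2 : ℤ) = -(y ^ 2 * (s ^ j) ^ 4 * s ^ 4)⁻¹ := by
    rw [hx, zpow_neg, zpow_ofNat, mul_pow, mul_pow, Complex.I_sq]
    rw [← inv_neg]
    congr 1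
    ring
  rw [classicalFactor, e1, e2, e3, e4, e5]
  congr 1
  · congr 1
    field_simp
    ring
  · field_simp
    ring

/-- The equation for `w = y s^(j + 1 - i)` eliminates `A₃`, and the potential difference then splits
into the four factors of `classicalFactor`. -/
theorem potential_sub_classical {A₃ : ℂ} (hs : Generic s) (hy : y ≠ 0) {i N : ℕ}
    (hij : i + 1 + j = N) (hw : LadderEquation s A₃ N (y * s ^ (j + 1) / s ^ i)) :
    potential s A₃ y - potential s A₃ (y * (s ^ 2) ^ (j + 1)) =
      -(y ^ 2 * ((1 - (s ^ j) ^ 2 * s ^ 2) * (1 - ((s ^ i) ^ 2 * s ^ 2)⁻¹) *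
        (1 - (y ^ 2 * (s ^ j) ^ 2 * s ^ 4)⁻¹) * (1 - (s ^ i) ^ 2 * (y ^ 2)⁻¹))) /
          (s ^ 2 - (s ^ 2)⁻¹) ^ 2 := by
  have h0 := hs.ne_zero
  have hk := hs.sub_inv_ne_zero
  rw [LadderEquation, zpow_neg, show (N + 1 : ℤ) = ((i + 1 + j + 1 : ℕ) : ℤ) by rw [← hij]; push_cast; ring,
    zpow_natCast] at hw
  rw [potential_sub, show A₃ * (s + s⁻¹) * (s ^ 2 - (s ^ 2)⁻¹) = - -(A₃ * (s + s⁻¹) * (s ^ 2 - (s ^ 2)⁻¹)) by ring,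
    ← hw]
  generalize s ^ 2 - (s ^ 2)⁻¹ = k at *
  have : (s ^ 2) ^ (j + 1) = (s ^ j) ^ 2 * s ^ 2 := by ring
  rw [this]
  simp only [pow_add, pow_one]
  have hS : s ^ i ≠ 0 := by positivity
  have hT : s ^ j ≠ 0 := by positivity
  generalize s ^ i = S at *
  generalize s ^ j = T at *
  field_simp
  ring

end Coefficients

/-- There is no loop, hence `t = a = 0`. The condition `hreg` on `w` keeps the parameters `±1` off
the ladder and the eigenvalues of `I₃` apart. -/
theorem ladderData_classical {s A₃ x : ℂ} {N : ℕ} (hs : Generic s)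
    (hx : IsClassicalParam (s ^ 2) s A₃ N x)
    (hreg : ∀ m : ℤ, -(N + 1) ≤ m → m ≤ N + 1 → (-Complex.I * x * (s ^ N)⁻¹) ^ 2 ≠ s ^ (2 * m)) :
    LadderData s A₃ N (-Complex.I * x * ((s ^ 2) ^ N)⁻¹) 0 0
      (fun j => -(x * s ^ (3 - 2 * j))
        / ((1 + x ^ (-2 : ℤ) * (s ^ 2) ^ (2 * j)) * (s ^ 2 - (s ^ 2)⁻¹) ^ 2) *
          classicalFactor (s ^ 2) N x j)
      (fun j => -(x⁻¹ * s ^ (2 * j - 1)) / (1 + x ^ (-2 : ℤ) * (s ^ 2) ^ (2 * j)))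
      (fun j => Complex.I * (x ^ 2 * (s ^ 2) ^ (2 - 2 * j))
        / ((1 + x ^ (-2 : ℤ) * (s ^ 2) ^ (2 * j)) * (s ^ 2 - (s ^ 2)⁻¹) ^ 2) *
          classicalFactor (s ^ 2) N x j)
      (fun j => -Complex.I * (x ^ (-2 : ℤ) * (s ^ 2) ^ (2 * j)) /
        (1 + x ^ (-2 : ℤ) * (s ^ 2) ^ (2 * j)))
      (fun j => -Complex.I * ((x * (s ^ 2) ^ (-(j : ℕ) : ℤ) - x⁻¹ * (s ^ 2) ^ ((j : ℕ) : ℤ)) /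
        (s ^ 2 - (s ^ 2)⁻¹))) := by
  have h0 := hs.ne_zero
  have hk := hs.sub_inv_ne_zero
  have hE := ladderEquation_classical hs hx
  have hx0 := hx.1
  have hI := Complex.I_ne_zero
  have hI2 := Complex.I_sq
  set w := -Complex.I * x * (s ^ N)⁻¹ with hw
  have hw0 : w ≠ 0 := mul_ne_zero (mul_ne_zero (neg_ne_zero.2 hI) hx0) (by positivity)
  have hxw : x = Complex.I * w * s ^ N := by
    rw [hw]
    field_simp
    linear_combination hI2
  have hz : -Complex.I * x * ((s ^ 2) ^ N)⁻¹ = w * (s ^ N)⁻¹ := by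
    rw [hw, ← pow_mul, mul_comm 2 N, pow_mul]
    field_simp
  rw [hz]
  have hsq : ∀ i ≤ N, (w * (s ^ N)⁻¹ * (s ^ 2) ^ i) ^ 2 ≠ 1 := by
    intro i hi e
    apply hreg (N - 2 * i) (by omega) (by omega)
    rw [zpow_eq_of_exponent h0 i N (-4) 2 0 (by ring)]
    simp only [zpow_neg, zpow_ofNat, pow_zero, mul_one]
    rw [← pow_mul s 2 i, mul_comm 2 i, pow_mul] at e
    field_simp at e ⊢
    linear_combination e
  have hpar : ∀ i j : ℕ, i + j = N →
      x = Complex.I * (w * (s ^ N)⁻¹ * (s ^ 2) ^ i) * (s ^ 2) ^ j := by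
    rintro i j rfl
    rw [hxw, ← pow_mul, ← pow_mul, mul_comm 2 i, mul_comm 2 j, pow_mul, pow_mul, pow_add]
    field_simp
  have hy0 : ∀ i, w * (s ^ N)⁻¹ * (s ^ 2) ^ i ≠ 0 := fun i => by positivity
  refine ⟨by positivity, ?_, hsq, ?_, ?_, ?_, ?_, ?_, by ring, Or.inl rfl, ?_⟩
  · intro i j hij
    have hx := hpar i j hij
    rw [spec, zpow_neg, zpow_natCast, mul_div_assoc']
    congr 1
    have hy := hy0 i
    generalize w * (s ^ N)⁻¹ * (s ^ 2) ^ i = y at *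
    rw [hx, mul_inv, mul_inv, Complex.inv_I]
    field_simp
    linear_combination -(y ^ 2 + 1) * hI2
  · intro i l hil hl e
    apply hreg (N - (i + l)) (by omega) (by omega)
    rw [zpow_eq_of_exponent h0 (i + l) N (-2) 2 0 (by push_cast; ring)]
    simp only [zpow_neg, zpow_ofNat, pow_zero, mul_one]
    rw [← pow_mul s 2 (i + l), mul_comm 2 (i + l), pow_mul] at e
    field_simp at e ⊢
    linear_combination e
  · intro i j hij
    have hx := hpar i j hij
    have h1 := hsq i (by omega)
    have hy := hy0 i
    generalize w * (s ^ N)⁻¹ * (s ^ 2) ^ i = y at *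
    simp only [mul_zpow_three h0 hx, sq_mul_zpow h0 hx]
    ring
  · intro i j hij
    have hx := hpar i j hij
    have hy := hy0 i
    generalize w * (s ^ N)⁻¹ * (s ^ 2) ^ i = y at *
    simp only [inv_mul_zpow h0 hx, inv_sq_mul_zpow h0 hx]
    field_simp
  · intro j hj
    have hx := hpar (N - j) j (by omega)
    have h1 := hsq (N - j) (by omega)
    have hy := hy0 (N - j)
    generalize w * (s ^ N)⁻¹ * (s ^ 2) ^ (N - j) = y at *
    simp only [inv_mul_zpow h0 hx, inv_sq_mul_zpow h0 hx]
    refine div_ne_zero (by simp [h0, hy, hI]) fun e => h1 ?_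
    field_simp at e
    linear_combination e
  · intro i j hij
    have hx := hpar i (j + 1) (by omega)
    have hx' := hpar (i + 1) j (by omega)
    have h1 := hsq i (by omega)
    have h1' := hsq (i + 1) (by omega)
    have hy := hy0 i
    rw [show w * (s ^ N)⁻¹ * (s ^ 2) ^ N = w * (s ^ N)⁻¹ * (s ^ 2) ^ i * (s ^ 2) ^ (j + 1) by
      rw [mul_assoc _ ((s ^ 2) ^ i), ← pow_add]
      congr 2
      omega]
    rw [show w * (s ^ N)⁻¹ * (s ^ 2) ^ (i + 1) = s ^ 2 * (w * (s ^ N)⁻¹ * (s ^ 2) ^ i) by ring] at *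
    have hE : LadderEquation s A₃ N (w * (s ^ N)⁻¹ * (s ^ 2) ^ i * s ^ (j + 1) / s ^ i) := by
      convert hE using 1
      rw [← hij, ← pow_mul s 2 i, mul_comm 2 i, pow_mul, show i + 1 + j = i + (j + 1) by ring,
        pow_add s i]
      field_simp
    generalize w * (s ^ N)⁻¹ * (s ^ 2) ^ i = y at *
    rw [potential_sub_classical hs hy hij hE]
    simp only [mul_zpow_three h0 hx, inv_mul_zpow h0 hx', inv_sq_mul_zpow h0 hx,
      inv_sq_mul_zpow h0 hx', classicalFactor_eq h0 hy hij hx]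
    generalize (1 - (s ^ j) ^ 2 * s ^ 2) * (1 - ((s ^ i) ^ 2 * s ^ 2)⁻¹) *
        (1 - (y ^ 2 * (s ^ j) ^ 2 * s ^ 4)⁻¹) * (1 - (s ^ i) ^ 2 * (y ^ 2)⁻¹) = G
    generalize s ^ 2 - (s ^ 2)⁻¹ = k at *
    have d1 : y ^ 2 - 1 ≠ 0 := sub_ne_zero.2 h1
    have d2 : (s ^ 2 * y) ^ 2 - 1 ≠ 0 := sub_ne_zero.2 h1'
    have r1 : 1 + -(y ^ 2)⁻¹ = (y ^ 2 - 1) / y ^ 2 := by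
      field_simp
      ring
    have r2 : 1 + -((s ^ 2 * y) ^ 2)⁻¹ = ((s ^ 2 * y) ^ 2 - 1) / (s ^ 2 * y) ^ 2 := by
      field_simp
      ring
    rw [← sub_eq_add_neg] at r1 r2
    rw [← sub_eq_add_neg, ← sub_eq_add_neg, r1, r2]
    generalize (s ^ 2 * y) ^ 2 - 1 = D at *
    field_simp
    linear_combination G * (y ^ 2 - 1) * hI2
  · rw [(potential_eq_iff_ladderEquation hs (by positivity) ?_).2 ?_]
    · ring
    · intro e
      apply hreg 0 (by omega) (by omega)
      rw [mul_zero, zpow_zero, ← e, pow_right_comm s 2 N]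
      field_simp
    · convert hE using 1
      field_simp

/-- The first two factors are nonzero because `q` is not a root of unity. The other two could vanish
only for `w² = q^(-1-i)` or `w² = q^(k+1)`, both covered by `hreg`. -/
theorem classical_down_ne_zero {s A₃ x : ℂ} {N : ℕ} (hs : Generic s)
    (hx : IsClassicalParam (s ^ 2) s A₃ N x)
    (hreg : ∀ m : ℤ, -(N + 1) ≤ m → m ≤ N + 1 → (-Complex.I * x * (s ^ N)⁻¹) ^ 2 ≠ s ^ (2 * m))
    (j : ℕ) (hj : 1 ≤ j) (hjN : j ≤ N) :
    -(x * s ^ (3 - 2 * (j : ℤ)))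
        / ((1 + x ^ (-2 : ℤ) * (s ^ 2) ^ (2 * (j : ℤ))) * (s ^ 2 - (s ^ 2)⁻¹) ^ 2) *
          classicalFactor (s ^ 2) N x j ≠ 0 := by
  have h0 := hs.ne_zero
  have hk := hs.sub_inv_ne_zero
  have hx0 := hx.1
  have hI := Complex.I_ne_zero
  have L := ladderData_classical hs hx hreg
  set w := -Complex.I * x * (s ^ N)⁻¹ with hw
  have hxw : x = Complex.I * w * s ^ N := by
    rw [hw]
    field_simp
    linear_combination Complex.I_sq
  have hw0 : w ≠ 0 := mul_ne_zero (mul_ne_zero (neg_ne_zero.2 hI) hx0) (by positivity)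
  obtain ⟨k, rfl⟩ : ∃ k, j = k + 1 := ⟨j - 1, by omega⟩
  obtain ⟨i, hi⟩ : ∃ i, i + 1 + k = N := ⟨N - (k + 1), by omega⟩
  set y := w * s ^ i / (s ^ (k + 1)) with hy
  have hy0 : y ≠ 0 := by positivity
  have hxy : x = Complex.I * y * (s ^ 2) ^ (k + 1) := by
    rw [hxw, hy, ← hi, pow_right_comm s 2, show i + 1 + k = i + (k + 1) by ring, pow_add s i]
    field_simp
  have hden : (1 + x ^ (-2 : ℤ) * (s ^ 2) ^ (2 * ((k + 1 : ℕ) : ℤ))) ≠ 0 := by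
    have := L.up_ne_zero (k + 1) hjN
    exact fun e => this (by simp only [e, div_zero])
  have hpow : ∀ n : ℕ, 0 < n → s ^ n ≠ 1 := fun n hn e =>
    hs.zpow_ne_one n (by omega) (by rw [zpow_natCast, e])
  refine mul_ne_zero (div_ne_zero (neg_ne_zero.2 (mul_ne_zero hx0 (zpow_ne_zero _ h0)))
    (mul_ne_zero hden (pow_ne_zero 2 hk))) ?_
  rw [classicalFactor_eq h0 hy0 hi hxy]
  refine mul_ne_zero (mul_ne_zero (mul_ne_zero ?_ ?_) ?_) ?_ <;> rw [sub_ne_zero, ne_comm]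
  · rw [← pow_mul, ← pow_add]
    exact hpow _ (by omega)
  · rw [ne_eq, inv_eq_one, ← pow_mul, ← pow_add]
    exact hpow _ (by omega)
  · rw [ne_eq, inv_eq_one]
    intro e
    apply hreg (-1 - i) (by omega) (by omega)
    rw [zpow_eq_of_exponent h0 i 0 (-2) 0 (-2) (by ring)]
    simp only [zpow_neg, zpow_ofNat, pow_zero, mul_one]
    rw [hy, pow_succ s k] at e
    field_simp at e ⊢
    linear_combination e
  · intro e
    apply hreg (k + 1) (by omega) (by omega)
    rw [zpow_eq_of_exponent h0 k 0 2 0 2 (by ring)]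
    simp only [zpow_ofNat, pow_zero, mul_one]
    rw [hy, pow_succ s k] at e
    field_simp at e
    exact e.symm

/-! ### The non-classical formulas form a ladder with a loop. -/

/-- The condition on `a` in the definition of the non-classical parameters. -/
theorem potential_sub_loop {s A₃ ε : ℂ} (N : ℕ) (hs : Generic s) (hε : ε = 1 ∨ ε = -1) :
    potential s A₃ (ε * s)⁻¹ - potential s A₃ (ε * s * (s ^ 2) ^ N) =
      -((s ^ 2)⁻¹) ^ 2 *
        (-s ^ 2 * (((s ^ 2) ^ (N + 1 : ℤ) - (s ^ 2) ^ (-(N + 1) : ℤ)) / (s ^ 2 - (s ^ 2)⁻¹)) ^ 2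
          - ε * s ^ 2 * (s + s⁻¹) * (s ^ (N + 1 : ℤ) - s ^ (-(N + 1) : ℤ)) ^ 2
            / (s ^ 2 - (s ^ 2)⁻¹) * A₃) := by
  have h0 := hs.ne_zero
  have hk := hs.sub_inv_ne_zero
  have e1 : (s ^ 2) ^ (N + 1 : ℤ) = (s ^ N) ^ 2 * s ^ 2 := by
    rw [sq_zpow_eq_of_exponent h0 N 0 2 0 2 (by ring)]
    simp
  have e2 : s ^ (N + 1 : ℤ) = s ^ N * s := by
    rw [zpow_eq_of_exponent h0 N 0 1 0 1 (by ring)]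
    simp
  rw [zpow_neg, zpow_neg, e1, e2, potential_sub, pow_right_comm s 2 N]
  have hS : s ^ N ≠ 0 := by positivity
  generalize s ^ N = S at *
  generalize s ^ 2 - (s ^ 2)⁻¹ = k at *
  rcases hε with rfl | rfl
  · field_simp
    ring
  · field_simp
    ring

/-- The ladder coefficients of a non-classical representation. -/
theorem potential_sub_nonclassical {s A₃ ε : ℂ} {i j N : ℕ} (hs : Generic s)
    (hε : ε = 1 ∨ ε = -1) (hij : i + j = N) :
    potential s A₃ (ε * s * (s ^ 2) ^ i) - potential s A₃ (ε * s * (s ^ 2) ^ N) =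
      -((s ^ i) ^ 2 * (1 - (s ^ j) ^ 2) * (1 - ((s ^ i) ^ 4 * (s ^ j) ^ 2 * s ^ 4)⁻¹) *
          nonclassicalFactor (s ^ 2) s A₃ N ε j) / (s ^ 2 - (s ^ 2)⁻¹) := by
  have h0 := hs.ne_zero
  have hk := hs.sub_inv_ne_zero
  have e1 : (s ^ 2) ^ ((N : ℤ) + 1 - j) = (s ^ i) ^ 2 * s ^ 2 := by
    rw [sq_zpow_eq_of_exponent h0 i j 2 0 2 (by rw [← hij]; push_cast; ring)]
    simp
  have e2 : (s ^ 2) ^ (-2 * (N : ℤ) - 2 + j) = ((s ^ i) ^ 4 * (s ^ j) ^ 2 * s ^ 4)⁻¹ := by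
    rw [sq_zpow_eq_of_exponent h0 i j (-4) (-2) (-4) (by rw [← hij]; push_cast; ring)]
    simp only [zpow_neg, zpow_ofNat]
    field_simp
  rw [potential_sub, nonclassicalFactor, e1, e2, zpow_natCast, ← hij, pow_right_comm s 2,
    pow_right_comm s 2, pow_right_comm s 2, pow_add]
  have hS : s ^ i ≠ 0 := by positivity
  have hT : s ^ j ≠ 0 := by positivity
  generalize s ^ i = S at *
  generalize s ^ j = T at *
  generalize s ^ 2 - (s ^ 2)⁻¹ = k at *
  rcases hε with rfl | rfl
  · field_simp
    ring
  · field_simp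
    ring

/-- The bottom `v_N` has parameter `ε s`, and the convention `v_{N+1} = a v_N` makes lowering there
a multiplication by `t = i ε q⁻¹ a`. The equation for `a²` is then the termination condition on
`t²`. -/
theorem ladderData_nonclassical {s A₃ ε a : ℂ} {N : ℕ} (hs : Generic s)
    (hp : (ε, a) ∈ nonclassicalParams (s ^ 2) s A₃ N) :
    LadderData s A₃ N (ε * s) (a * (Complex.I * ε * ((s ^ 2)⁻¹))) a
      (fun j => Complex.I * ε / (1 - (s ^ 2) ^ (-2 * N + 2 * j - 1))
        * (-s ^ 2 * ((1 - (s ^ 2) ^ j) * (1 - (s ^ 2) ^ (-2 * N - 2 + j)) / (s ^ 2 - (s ^ 2)⁻¹))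
          * nonclassicalFactor (s ^ 2) s A₃ N ε j))
      (fun j => Complex.I * ε / (1 - (s ^ 2) ^ (-2 * N + 2 * j - 1)) * (s ^ 2) ^ (-N - 1 + j))
      (fun j => Complex.I / (1 - (s ^ 2) ^ (-2 * N + 2 * j - 1))
        * (-(s ^ 2) ^ (N - j + 2) *
          ((1 - (s ^ 2) ^ j) * (1 - (s ^ 2) ^ (-2 * N - 2 + j)) / (s ^ 2 - (s ^ 2)⁻¹))
          * nonclassicalFactor (s ^ 2) s A₃ N ε j))
      (fun j => Complex.I / (1 - (s ^ 2) ^ (-2 * N + 2 * j - 1)) *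
        (s ^ 2) ^ (-2 * N + 2 * j - 1))
      (fun j => ε * ((s ^ (2 * (N - (j : ℕ)) + 1 : ℤ) + s ^ (-(2 * (N - (j : ℕ)) + 1) : ℤ)) /
        (s ^ 2 - (s ^ 2)⁻¹))) := by
  have h0 := hs.ne_zero
  have hk := hs.sub_inv_ne_zero
  have hI := Complex.I_ne_zero
  have hI2 := Complex.I_sq
  obtain ⟨hε, ha⟩ := hp
  simp only at hε ha
  have hε2 : ε ^ 2 = 1 := by rcases hε with rfl | rfl <;> norm_num
  have hεi : ε⁻¹ = ε := by rcases hε with rfl | rfl <;> norm_num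
  have hε0 : ε ≠ 0 := by rcases hε with rfl | rfl <;> norm_num
  have hpow : ∀ n : ℕ, 0 < n → s ^ n ≠ 1 := fun n hn e =>
    hs.zpow_ne_one n (by omega) (by rw [zpow_natCast, e])
  have hsq : ∀ i, (ε * s * (s ^ 2) ^ i) ^ 2 = (s ^ i) ^ 4 * s ^ 2 := by
    intro i
    rw [mul_pow, mul_pow, hε2, pow_right_comm s 2 i]
    ring
  have hne : ∀ i, (s ^ i) ^ 4 * s ^ 2 ≠ 1 := by
    intro i
    rw [← pow_mul, ← pow_add]
    exact hpow _ (by omega)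
  have e1 : ∀ i j : ℕ, i + j = N → (s ^ 2) ^ (-2 * (N : ℤ) + 2 * j - 1) =
      ((s ^ i) ^ 4 * s ^ 2)⁻¹ := by
    intro i j hij
    rw [sq_zpow_eq_of_exponent h0 i j (-4) 0 (-2) (by rw [← hij]; push_cast; ring)]
    simp only [zpow_neg, zpow_ofNat, pow_zero]
    field_simp
  have e2 : ∀ i j : ℕ, i + j = N → (s ^ 2) ^ (-(N : ℤ) - 1 + j) = ((s ^ i) ^ 2 * s ^ 2)⁻¹ := by
    intro i j hij
    rw [sq_zpow_eq_of_exponent h0 i j (-2) 0 (-2) (by rw [← hij]; push_cast; ring)]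
    simp only [zpow_neg, zpow_ofNat, pow_zero]
    field_simp
  have e3 : ∀ i j : ℕ, i + j = N → (s ^ 2) ^ ((N : ℤ) - j + 2) = (s ^ i) ^ 2 * s ^ 4 := by
    intro i j hij
    rw [sq_zpow_eq_of_exponent h0 i j 2 0 4 (by rw [← hij]; push_cast; ring)]
    simp only [zpow_ofNat, pow_zero, mul_one]
  have e4 : ∀ i j : ℕ, i + j = N → (s ^ 2) ^ (-2 * (N : ℤ) - 2 + j) =
      ((s ^ i) ^ 4 * (s ^ j) ^ 2 * s ^ 4)⁻¹ := by
    intro i j hij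
    rw [sq_zpow_eq_of_exponent h0 i j (-4) (-2) (-4) (by rw [← hij]; push_cast; ring)]
    simp only [zpow_neg, zpow_ofNat]
    field_simp
  have r : ∀ i, 1 - ((s ^ i) ^ 4 * s ^ 2)⁻¹ = ((s ^ i) ^ 4 * s ^ 2 - 1) / ((s ^ i) ^ 4 * s ^ 2) := by
    intro i
    field_simp
  have hd : ∀ i, (s ^ i) ^ 4 * s ^ 2 - 1 ≠ 0 := fun i => sub_ne_zero.2 (hne i)
  refine ⟨mul_ne_zero hε0 h0, ?_, ?_, ?_, ?_, ?_, ?_, ?_, ?_, Or.inr ?_, ?_⟩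
  · intro i j hij
    have hij' : (N : ℤ) = i + (j : ℕ) := by exact_mod_cast hij.symm
    rw [zpow_neg, zpow_eq_of_exponent h0 i j 2 0 1 (by linear_combination 2 * hij'), spec,
      pow_right_comm s 2 i, mul_div_assoc']
    congr 1
    simp only [zpow_ofNat, pow_zero, pow_one, mul_one, mul_inv, hεi]
    ring
  · intro i _
    rw [hsq]
    exact hne i
  · intro i l _ _
    rw [mul_pow, hε2, one_mul, ← pow_mul, ← pow_add]
    exact hpow _ (by omega)
  · intro i j hij
    simp only [e3 i j hij, pow_right_comm s 2 i]
    rcases hε with rfl | rfl <;> ring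
  · intro i j hij
    simp only [e1 i j hij, e2 i j hij, pow_right_comm s 2 i, div_eq_mul_inv]
    generalize (1 - ((s ^ i) ^ 4 * s ^ 2)⁻¹)⁻¹ = D
    field_simp
  · intro j hj
    simp only [e1 (N - j) j (by omega), e2 (N - j) j (by omega), r]
    have := hd (N - j)
    positivity
  · intro i j hij
    rw [potential_sub_nonclassical hs hε (j := j + 1) (by omega), hsq, hsq]
    simp only [e1 i (j + 1) (by omega), e1 (i + 1) j hij, e2 (i + 1) j hij,
      e4 i (j + 1) (by omega), r, zpow_natCast, pow_right_comm s 2 (j + 1)]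
    generalize nonclassicalFactor (s ^ 2) s A₃ N ε (j + 1 : ℕ) = F
    generalize s ^ 2 - (s ^ 2)⁻¹ = k at *
    have d1 := hd i
    have d2 := hd (i + 1)
    rw [show 1 - (s ^ i) ^ 4 * s ^ 2 = -((s ^ i) ^ 4 * s ^ 2 - 1) by ring, pow_succ s i] at *
    generalize (s ^ i) ^ 4 * s ^ 2 - 1 = D at *
    generalize (s ^ i * s) ^ 4 * s ^ 2 - 1 = D' at *
    generalize 1 - ((s ^ i) ^ 4 * (s ^ (j + 1)) ^ 2 * s ^ 4)⁻¹ = E at *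
    generalize 1 - (s ^ (j + 1)) ^ 2 = E' at *
    field_simp
    linear_combination (E * E' * F) * (ε ^ 2 * hI2 - hε2)
  · have E1 := e1 0 N (by omega)
    have E2 := e2 0 N (by omega)
    simp only [pow_zero, one_pow, one_mul] at E1 E2
    simp only [E1, E2]
    rw [mul_pow, hε2, one_mul]
    have : 1 - (s ^ 2)⁻¹ ≠ 0 := by
      rw [sub_ne_zero, ne_comm, ne_eq, inv_eq_one]
      exact hs.sq_ne_one
    generalize 1 - (s ^ 2)⁻¹ = k at *
    field_simp
  · rw [mul_pow, hε2, one_mul]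
  · rw [potential_sub_loop N hs hε, mul_pow, ha, mul_pow, mul_pow, hI2, hε2]
    ring

/-! ### From triples of operators to representations of the algebra. -/

section Algebra

variable {s A₃ : ℂ} {V : Type*} [AddCommGroup V] [Module ℂ V]

theorem exists_rep {X₁ X₂ X₃ : Module.End ℂ V} (h : ∀ v, RelationsAt s A₃ X₁ X₂ X₃ v) :
    ∃ ρ : AW s 0 0 A₃ →ₐ[ℂ] Module.End ℂ V,
      ρ (gen 0) = X₁ ∧ ρ (gen 1) = X₂ ∧ ρ (gen 2) = X₃ := by
  let f : FreeAlgebra ℂ (Fin 3) →ₐ[ℂ] Module.End ℂ V := FreeAlgebra.lift ℂ ![X₁, X₂, X₃]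
  have hf : ∀ ⦃x y⦄, Rel s 0 0 A₃ x y → f x = f y := by
    intro x y hxy
    ext v
    cases hxy
    · simpa [f, Module.algebraMap_end_apply] using (h v).rel₁
    · simpa [f] using (h v).rel₂
    · simpa [f] using (h v).rel₃
  refine ⟨RingQuot.liftAlgHom ℂ ⟨f, hf⟩, ?_, ?_, ?_⟩ <;>
    simp [gen, RingQuot.liftAlgHom_mkAlgHom_apply, f]

theorem relationsAt_rep (ρ : AW s 0 0 A₃ →ₐ[ℂ] Module.End ℂ V) (v : V) :
    RelationsAt s A₃ (ρ (gen 0)) (ρ (gen 1)) (ρ (gen 2)) v := by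
  have key : ∀ {x y}, Rel s 0 0 A₃ x y →
      ρ (RingQuot.mkAlgHom ℂ _ x) v = ρ (RingQuot.mkAlgHom ℂ _ y) v := fun h => by
    rw [RingQuot.mkAlgHom_rel ℂ h]
  refine ⟨?_, ?_, ?_⟩
  · simpa [gen, Module.algebraMap_end_apply] using key Rel.rel₁
  · simpa [gen] using key Rel.rel₂
  · simpa [gen] using key Rel.rel₃

/-- Applied to the subalgebra preserving a subspace and to the one commuting with a linear
equivalence, this reduces irreducibility and equivalence to the generators. -/
theorem mem_of_gen_mem {A₁ A₂ : ℂ} (S : Subalgebra ℂ (AW s A₁ A₂ A₃)) (h0 : gen 0 ∈ S)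
    (h1 : gen 1 ∈ S) (h2 : gen 2 ∈ S) (a : AW s A₁ A₂ A₃) : a ∈ S := by
  obtain ⟨f, rfl⟩ := RingQuot.mkAlgHom_surjective ℂ (Rel s A₁ A₂ A₃) a
  induction f using FreeAlgebra.induction with
  | grade0 r =>
    rw [AlgHom.commutes]
    exact S.algebraMap_mem r
  | grade1 i =>
    fin_cases i
    · exact h0
    · exact h1
    · exact h2
  | mul a b ha hb =>
    rw [map_mul]
    exact S.mul_mem ha hb
  | add a b ha hb =>
    rw [map_add]
    exact S.add_mem ha hb

theorem isIrreducible_iff (ρ : AW s 0 0 A₃ →ₐ[ℂ] Module.End ℂ V) :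
    IsIrreducible ρ ↔ Nontrivial V ∧ Irreducible (ρ (gen 0)) (ρ (gen 1)) (ρ (gen 2)) := by
  refine and_congr_right fun _ => forall_congr' fun W => imp_congr_left ⟨fun h w hw =>
    ⟨h _ w hw, h _ w hw, h _ w hw⟩, fun h a => ?_⟩
  let S : Subalgebra ℂ (AW s 0 0 A₃) :=
    { carrier := {a | ∀ w ∈ W, ρ a w ∈ W}
      mul_mem' := fun {a b} ha hb w hw => by
        rw [map_mul]
        exact ha _ (hb w hw)
      add_mem' := fun {a b} ha hb w hw => by
        rw [map_add]
        exact W.add_mem (ha w hw) (hb w hw)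
      algebraMap_mem' := fun r w hw => by
        rw [AlgHom.commutes]
        exact W.smul_mem r hw }
  exact mem_of_gen_mem S (fun w hw => (h w hw).1) (fun w hw => (h w hw).2.1)
    (fun w hw => (h w hw).2.2) a

theorem isEquivRep_of_gen {V' : Type*} [AddCommGroup V'] [Module ℂ V']
    {ρ : AW s 0 0 A₃ →ₐ[ℂ] Module.End ℂ V} {ρ' : AW s 0 0 A₃ →ₐ[ℂ] Module.End ℂ V'}
    (h : ∃ φ : V ≃ₗ[ℂ] V', ∀ v, φ (ρ (gen 0) v) = ρ' (gen 0) (φ v) ∧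
      φ (ρ (gen 1) v) = ρ' (gen 1) (φ v) ∧ φ (ρ (gen 2) v) = ρ' (gen 2) (φ v)) :
    IsEquivRep ρ ρ' := by
  obtain ⟨φ, h⟩ := h
  refine ⟨φ, fun a => ?_⟩
  let S : Subalgebra ℂ (AW s 0 0 A₃) :=
    { carrier := {a | ∀ v, φ (ρ a v) = ρ' a (φ v)}
      mul_mem' := fun {a b} ha hb v => by
        rw [map_mul, map_mul, Module.End.mul_apply, Module.End.mul_apply, ha, hb]
      add_mem' := fun {a b} ha hb v => by
        rw [map_add, map_add, LinearMap.add_apply, LinearMap.add_apply, map_add, ha, hb]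
      algebraMap_mem' := fun r v => by
        rw [AlgHom.commutes, AlgHom.commutes]
        exact map_smul φ r v }
  exact mem_of_gen_mem S (fun v => (h v).1) (fun v => (h v).2.1) (fun v => (h v).2.2) a

theorem avoidsEigenvalues_iff (ρ : AW s 0 0 A₃ →ₐ[ℂ] Module.End ℂ V) :
    AvoidsEigenvalues (s ^ 2) ρ ↔ Avoids s (ρ (gen 2)) := by
  have hspec : ∀ ε : ℂ, ε = 1 ∨ ε = -1 → spec s ε = 2 * ε / (s ^ 2 - (s ^ 2)⁻¹) := by
    rintro ε (rfl | rfl) <;> rw [spec] <;> norm_num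
  constructor
  · intro h v y hy hv
    by_contra hv0
    have hy' : y = 1 ∨ y = -1 := sq_eq_sq_iff_eq_or_eq_neg.1 (by rw [hy, one_pow])
    refine h y hy' (Module.End.hasEigenvalue_of_hasEigenvector
      ⟨Module.End.mem_eigenspace_iff.2 ?_, hv0⟩)
    rw [← hspec y hy', hv]
  · intro h ε hε he
    obtain ⟨v, hv⟩ := he.exists_hasEigenvector
    refine hv.2 (h v ε ?_ ?_)
    · rcases hε with rfl | rfl <;> norm_num
    · rw [hspec ε hε]
      exact hv.apply_eq_smul

end Algebra

/-! ### Parameter equations in terms of `w`, and pairs of square roots. -/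

theorem isExcluded_iff {s A₃ ε : ℂ} {N : ℕ} {k : ℤ} (hs : Generic s) (hε : ε = 1 ∨ ε = -1) :
    IsExcluded (s ^ 2) s A₃ N k ε ↔ LadderEquation s A₃ N (ε * s ^ (k - N)) := by
  have hk := hs.sub_inv_ne_zero
  rw [IsExcluded, LadderEquation, div_eq_iff hk, mul_inv, ← zpow_neg]
  rcases hε with rfl | rfl
  · constructor <;> intro h <;> linear_combination h
  · rw [inv_neg, inv_one]
    constructor <;> intro h <;> linear_combination -h

/-- The substitution `w = -i x q^{-N/2}` turns the equation for `x` into the equation for `w`. -/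
theorem isClassicalParam_iff {s A₃ w : ℂ} {N : ℕ} (hs : Generic s) (hw : w ≠ 0) :
    IsClassicalParam (s ^ 2) s A₃ N (Complex.I * w * s ^ N) ↔ LadderEquation s A₃ N w := by
  have h0 := hs.ne_zero
  have hI := Complex.I_ne_zero
  have e : -Complex.I * (Complex.I * w * s ^ N) * (s ^ N)⁻¹ = w := by
    field_simp
    linear_combination -Complex.I_sq
  constructor
  · intro h
    have := ladderEquation_classical hs h
    rwa [e] at this
  · intro h
    refine ⟨by positivity, ?_⟩
    rw [LadderEquation] at h
    rw [mul_div_assoc', div_eq_iff hs.sub_inv_ne_zero, zpow_neg s (N : ℤ), zpow_natCast, mul_inv,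
      mul_inv, Complex.inv_I]
    have : s ^ N * (s ^ N)⁻¹ = 1 := mul_inv_cancel₀ (by positivity)
    linear_combination Complex.I * h + (s ^ (N + 1 : ℤ) + s ^ (-(N + 1) : ℤ)) * Complex.I * (w + w⁻¹) * this

theorem exists_ladderEquation {s : ℂ} (A₃ : ℂ) (N : ℕ) (hs : Generic s) :
    ∃ w, w ≠ 0 ∧ LadderEquation s A₃ N w := by
  have hk := hs.sub_inv_ne_zero
  have hc := hs.zpow_add_zpow_neg_ne_zero (N + 1)
  obtain ⟨w, hw, h⟩ := exists_spec_eq hs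
    (-(A₃ * (s + s⁻¹)) / (s ^ (N + 1 : ℤ) + s ^ (-(N + 1) : ℤ)))
  refine ⟨w, hw, ?_⟩
  rw [spec, div_eq_div_iff hk hc] at h
  rw [LadderEquation]
  linear_combination h

theorem ncard_sq_roots (R : ℂ → ℂ) (h : ¬(R 1 = 0 ∧ R (-1) = 0)) :
    {p : ℂ × ℂ | (p.1 = 1 ∨ p.1 = -1) ∧ p.2 ^ 2 = R p.1}.ncard =
      if R 1 = 0 ∨ R (-1) = 0 then 3 else 4 := by
  classical
  obtain ⟨a, ha⟩ := IsAlgClosed.exists_pow_nat_eq (R 1) (n := 2) (by norm_num)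
  obtain ⟨b, hb⟩ := IsAlgClosed.exists_pow_nat_eq (R (-1)) (n := 2) (by norm_num)
  have hset : {p : ℂ × ℂ | (p.1 = 1 ∨ p.1 = -1) ∧ p.2 ^ 2 = R p.1} =
      (({(1, a), (1, -a), (-1, b), (-1, -b)} : Finset (ℂ × ℂ)) : Set (ℂ × ℂ)) := by
    ext ⟨ε, c⟩
    simp only [Set.mem_ofPred_eq, Finset.coe_insert, Finset.coe_singleton, Set.mem_insert_iff,
      Set.mem_singleton_iff, Prod.mk.injEq]
    constructor
    · rintro ⟨rfl | rfl, h⟩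
      · rw [← ha, sq_eq_sq_iff_eq_or_eq_neg] at h
        tauto
      · rw [← hb, sq_eq_sq_iff_eq_or_eq_neg] at h
        tauto
    · rintro (⟨rfl, rfl⟩ | ⟨rfl, rfl⟩ | ⟨rfl, rfl⟩ | ⟨rfl, rfl⟩) <;> simp [*]
  rw [hset, Set.ncard_coe_finset]
  have h1 : (1 : ℂ) ≠ -1 := by norm_num
  have hneg : ∀ c : ℂ, c = -c ↔ c = 0 := fun c => self_eq_neg
  have hR : R 1 = 0 ↔ a = 0 := by rw [← ha, pow_eq_zero_iff two_ne_zero]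
  have hR' : R (-1) = 0 ↔ b = 0 := by rw [← hb, pow_eq_zero_iff two_ne_zero]
  simp only [hR, hR'] at h ⊢
  by_cases ha0 : a = 0
  · have hb0 : b ≠ 0 := fun hb0 => h ⟨ha0, hb0⟩
    subst ha0
    simp [hb0, h1, hneg]
  · by_cases hb0 : b = 0
    · subst hb0
      simp [ha0, h1, hneg]
    · simp [ha0, hb0, h1, hneg]

/-! ### Comparing ladder representations, and counting the pairs `(ε, a)`. -/

section Ladders

variable {s A₃ : ℂ} {N : ℕ} {z t a : ℂ} {d u d' u' : ℤ → ℂ} {lam : Fin (N + 1) → ℂ}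

/-- The representation given by ladder matrices. -/
theorem LadderData.exists_coordRep (hs : Generic s) (L : LadderData s A₃ N z t a d u d' u' lam) :
    ∃ ρ : CoordRep s A₃ N, HasMatrices ρ (shiftMatrix N a d u) (shiftMatrix N a d' u')
      (Matrix.diagonal lam) :=
  exists_rep (L.relationsAt hs)

theorem LadderData.avoidsEigenvalues (hs : Generic s) (L : LadderData s A₃ N z t a d u d' u' lam)
    {ρ : CoordRep s A₃ N} (hρ : HasMatrices ρ (shiftMatrix N a d u) (shiftMatrix N a d' u')
      (Matrix.diagonal lam)) : AvoidsEigenvalues (s ^ 2) ρ := by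
  rw [avoidsEigenvalues_iff, hρ.2.2]
  exact L.avoids hs

theorem LadderData.isIrreducible_iff (hs : Generic s) (L : LadderData s A₃ N z t a d u d' u' lam)
    {ρ : CoordRep s A₃ N} (hρ : HasMatrices ρ (shiftMatrix N a d u) (shiftMatrix N a d' u')
      (Matrix.diagonal lam)) : IsIrreducible ρ ↔ ∀ j : ℕ, 1 ≤ j → j ≤ N → d j ≠ 0 := by
  rw [AskeyWilson.isIrreducible_iff, hρ.1, hρ.2.1, hρ.2.2, L.irreducible_iff hs, and_iff_right]
  infer_instance

/-- An irreducible representation with a matching bottom vector is equivalent to the one given by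
ladder matrices. -/
theorem LadderData.isEquivRep (hs : Generic s) (L : LadderData s A₃ N z t a d u d' u' lam)
    {ρ : CoordRep s A₃ N} (hρ : HasMatrices ρ (shiftMatrix N a d u) (shiftMatrix N a d' u')
      (Matrix.diagonal lam)) {V : Type*} [AddCommGroup V] [Module ℂ V]
    {σ : AW s 0 0 A₃ →ₐ[ℂ] Module.End ℂ V} (hN : Module.finrank ℂ V = N + 1)
    (hirr : IsIrreducible σ) (hav : AvoidsEigenvalues (s ^ 2) σ) {v : V} (hv0 : v ≠ 0)
    (hv : IsBottom s (σ (gen 0)) (σ (gen 1)) (σ (gen 2)) z t v)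
    (hres : NonResonant s (σ (gen 0)) (σ (gen 1)) z v) : IsEquivRep σ ρ := by
  have hrel := relationsAt_rep σ
  have hirr := ((AskeyWilson.isIrreducible_iff σ).1 hirr).2
  have hav := (avoidsEigenvalues_iff σ).1 hav
  obtain ⟨hlast, hne, -, hP⟩ := climb_irreducible hs hrel hN hirr hav hv hv0 hres
  refine isEquivRep_of_gen ?_
  rw [hρ.1, hρ.2.1, hρ.2.2]
  refine exists_linearEquiv_of_climb hs hrel (L.relationsAt hs) hN (by simp) hav hv
    (L.isBottom hs) hres hne (fun i hi => L.climb_ne_zero hs (fun j hj hjN hd => ?_) hi) hlast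
    (L.climb_last hs)
  -- The coefficients `d` are nonzero because `σ` is irreducible: their nonvanishing follows from
  -- inequalities between potentials that involve only `z`, `N` and `A₃`.
  obtain ⟨k, rfl⟩ : ∃ k, j = k + 1 := ⟨j - 1, by omega⟩
  refine hP (N - (k + 1)) (by omega) (sub_eq_zero.1 ?_)
  rw [← L.prod (N - (k + 1)) k (by omega), hd, zero_mul, zero_mul]

/-- Equivalent ladder representations have the same spectrum of `I₃`. -/
theorem LadderData.exists_spec_eq_spec {z' t' a' : ℂ} {e f e' f' : ℤ → ℂ}
    {lam' : Fin (N + 1) → ℂ} (L : LadderData s A₃ N z t a d u d' u' lam)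
    (L' : LadderData s A₃ N z' t' a' e f e' f' lam') {ρ ρ' : CoordRep s A₃ N}
    (hρ : HasMatrices ρ (shiftMatrix N a d u) (shiftMatrix N a d' u') (Matrix.diagonal lam))
    (hρ' : HasMatrices ρ' (shiftMatrix N a' e f) (shiftMatrix N a' e' f') (Matrix.diagonal lam'))
    (h : IsEquivRep ρ ρ') {i : ℕ} (hi : i ≤ N) :
    ∃ l ≤ N, spec s (z * (s ^ 2) ^ i) = spec s (z' * (s ^ 2) ^ l) := by
  obtain ⟨φ, h⟩ := h
  have h3 := h (gen 2) (stdVec N (N - i))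
  rw [hρ.2.2, hρ'.2.2, L.diagonal_stdVec (i := i) (by omega), map_smul] at h3
  have hne : φ (stdVec N (N - i)) ≠ 0 := fun e =>
    stdVec_ne_zero (N := N) (k := N - i) (by omega) (φ.map_eq_zero_iff.1 e)
  obtain ⟨j, hj⟩ := Function.ne_iff.1 hne
  exact ⟨N - j, by omega, L'.eq_spec_of_eigenvector h3.symm hj (by omega)⟩

/-- The loop at `v_N` gives the only diagonal entry, so the trace of `I₁` is an invariant that
detects `a`. -/
theorem trace_shiftMatrix (N : ℕ) (a : ℂ) (d u : ℤ → ℂ) :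
    (shiftMatrix N a d u).trace = a * u N := by
  rw [Matrix.trace, Finset.sum_eq_single (Fin.last N)]
  · simp [shiftMatrix]
  · intro i _ hi
    have : (i : ℕ) ≠ N := fun e => hi (Fin.ext e)
    simp [shiftMatrix, this]
  · simp

theorem IsEquivRep.trace_eq {ρ ρ' : CoordRep s A₃ N} {a' : ℂ} {e f e' f' : ℤ → ℂ}
    {lam' : Fin (N + 1) → ℂ}
    (hρ : HasMatrices ρ (shiftMatrix N a d u) (shiftMatrix N a d' u') (Matrix.diagonal lam))
    (hρ' : HasMatrices ρ' (shiftMatrix N a' e f) (shiftMatrix N a' e' f') (Matrix.diagonal lam'))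
    (h : IsEquivRep ρ ρ') : a * u N = a' * f N := by
  obtain ⟨φ, h⟩ := h
  rw [← trace_shiftMatrix N a d u, ← trace_shiftMatrix N a' e f, ← Matrix.trace_toLin'_eq,
    ← Matrix.trace_toLin'_eq, ← hρ.1, ← hρ'.1, ← LinearMap.trace_conj' (ρ (gen 0)) φ]
  congr 1
  refine LinearMap.ext fun v => ?_
  rw [LinearEquiv.conj_apply_apply, h, LinearEquiv.apply_symm_apply]

end Ladders

theorem spec_sign_zpow_eq {s ε ε' : ℂ} (hs : Generic s) (hε : ε = 1 ∨ ε = -1)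
    (hε' : ε' = 1 ∨ ε' = -1) {m n : ℤ}
    (h : spec s (ε * s ^ m) = spec s (ε' * s ^ n)) : ε = ε' := by
  have h0 := hs.ne_zero
  have hε0 : ε ≠ 0 := by rcases hε with rfl | rfl <;> norm_num
  have hε0' : ε' ≠ 0 := by rcases hε' with rfl | rfl <;> norm_num
  rcases (spec_eq_spec_iff hs (mul_ne_zero hε0 (zpow_ne_zero _ h0))
    (mul_ne_zero hε0' (zpow_ne_zero _ h0))).1 h with e | e
  · rcases hε with rfl | rfl <;> rcases hε' with rfl | rfl
    · rfl
    · exact (hs.zpow_ne_neg_zpow m n (by linear_combination e)).elim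
    · exact (hs.zpow_ne_neg_zpow m n (by linear_combination -e)).elim
    · rfl
  · rcases hε with rfl | rfl <;> rcases hε' with rfl | rfl
    · rfl
    · refine (hs.zpow_ne_neg_one (m + n) ?_).elim
      rw [zpow_add₀ h0]
      linear_combination -e
    · refine (hs.zpow_ne_neg_one (m + n) ?_).elim
      rw [zpow_add₀ h0]
      linear_combination -e
    · rfl

/-- The right-hand side of the condition on `a`. -/
def loopSq (s A₃ : ℂ) (N : ℕ) (ε : ℂ) : ℂ :=
  -s ^ 2 * (((s ^ 2) ^ (N + 1 : ℤ) - (s ^ 2) ^ (-(N + 1) : ℤ)) / (s ^ 2 - (s ^ 2)⁻¹)) ^ 2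
    - ε * s ^ 2 * (s + s⁻¹) * (s ^ (N + 1 : ℤ) - s ^ (-(N + 1) : ℤ)) ^ 2 / (s ^ 2 - (s ^ 2)⁻¹) * A₃

/-- After a nonzero factor is removed, what remains is the equation for an excluded value. The two
indices are exchanged by `k ↦ 2N - k`, which leaves that equation unchanged. -/
theorem loopSq_eq_zero_iff {s A₃ ε : ℂ} {N : ℕ} {k : ℤ} (hs : Generic s)
    (hk : k = 2 * N + 1 ∨ k = -1) : loopSq s A₃ N ε = 0 ↔ IsExcluded (s ^ 2) s A₃ N k ε := by
  have h0 := hs.ne_zero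
  have hκ := hs.sub_inv_ne_zero
  have hS : s ^ (N + 1 : ℤ) - s ^ (-(N + 1) : ℤ) ≠ 0 := fun e => by
    have := hs.zpow_injective (sub_eq_zero.1 e)
    omega
  have hexp : s ^ (k - N) + s ^ (-(k - N)) = s ^ (N + 1 : ℤ) + s ^ (-(N + 1) : ℤ) := by
    rcases hk with rfl | rfl
    · congr 2 <;> ring
    · rw [add_comm]
      congr 2 <;> ring
  have hfac : loopSq s A₃ N ε = -s ^ 2 * (s ^ (N + 1 : ℤ) - s ^ (-(N + 1) : ℤ)) ^ 2 /
      (s ^ 2 - (s ^ 2)⁻¹) * ((s ^ (N + 1 : ℤ) + s ^ (-(N + 1) : ℤ)) *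
        (s ^ (N + 1 : ℤ) + s ^ (-(N + 1) : ℤ)) / (s ^ 2 - (s ^ 2)⁻¹) + ε * (s + s⁻¹) * A₃) := by
    rw [loopSq, zpow_neg, zpow_neg, ← zpow_ofNat s 2, ← zpow_mul, mul_comm (2 : ℤ), zpow_mul,
      zpow_ofNat, zpow_ofNat]
    have hT : s ^ (N + 1 : ℤ) ≠ 0 := zpow_ne_zero _ h0
    generalize s ^ (N + 1 : ℤ) = T at *
    generalize s ^ 2 - (s ^ 2)⁻¹ = κ at *
    field_simp
    ring
  rw [IsExcluded, hexp, hfac, mul_eq_zero, or_iff_right]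
  · rw [add_eq_zero_iff_eq_neg]
    ring_nf
  · exact div_ne_zero (mul_ne_zero (neg_ne_zero.2 (pow_ne_zero 2 h0)) (pow_ne_zero 2 hS)) hκ

/-- Each sign contributes two roots `a`, or one if its right-hand side is zero. Both cannot be zero:
adding the two equations would remove `A₃` and leave a nonzero number equal to zero. -/
theorem ncard_nonclassicalParams {s : ℂ} (A₃ : ℂ) (N : ℕ) (hs : Generic s) :
    (nonclassicalParams (s ^ 2) s A₃ N).ncard =
      if loopSq s A₃ N 1 = 0 ∨ loopSq s A₃ N (-1) = 0 then 3 else 4 := by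
  refine ncard_sq_roots (loopSq s A₃ N) fun ⟨h1, h2⟩ => ?_
  rw [loopSq_eq_zero_iff hs (Or.inl rfl), IsExcluded] at h1
  rw [loopSq_eq_zero_iff hs (Or.inl rfl), IsExcluded] at h2
  have h3 := (by linear_combination (h1 + h2) / 2 :
    (s ^ (N + 1 : ℤ) + s ^ (-(N + 1) : ℤ)) * (s ^ (2 * N + 1 - N : ℤ) + s ^ (-(2 * N + 1 - N) : ℤ)) /
      (s ^ 2 - (s ^ 2)⁻¹) = 0)
  exact div_ne_zero (mul_ne_zero (hs.zpow_add_zpow_neg_ne_zero _)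
    (hs.zpow_add_zpow_neg_ne_zero _)) hs.sub_inv_ne_zero h3

theorem generic_of_sq {s : ℂ} (hq₀ : s ^ 2 ≠ 0) (hq : ∀ n : ℕ, 0 < n → (s ^ 2) ^ n ≠ 1) :
    Generic s := by
  refine ⟨fun h => hq₀ (by rw [h]; norm_num), fun n hn e => hq n.natAbs (by omega) ?_⟩
  have : s ^ n.natAbs = 1 := by
    rw [← zpow_natCast]
    rcases Int.natAbs_eq n with h | h
    · rw [← h, e]
    · rw [h, zpow_neg, inv_eq_one] at e
      exact e
  rw [pow_right_comm, this, one_pow]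

/-! ### Non-classical representations: irreducibility, inequivalence, classification. -/

section Nonclassical

variable {s A₃ ε a ε' a' : ℂ} {N : ℕ}

theorem nonclassical_isIrreducible_iff (hs : Generic s)
    (hp : (ε, a) ∈ nonclassicalParams (s ^ 2) s A₃ N) {ρ : CoordRep s A₃ N}
    (hρ : HasMatrices ρ (nonclassicalI₁ (s ^ 2) s A₃ N ε a) (nonclassicalI₂ (s ^ 2) s A₃ N ε a)
      (nonclassicalI₃ (s ^ 2) s N ε)) :
    IsIrreducible ρ ↔ ∀ j : ℤ, 1 ≤ j → j ≤ N → nonclassicalFactor (s ^ 2) s A₃ N ε j ≠ 0 := by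
  have h0 := hs.ne_zero
  have L := ladderData_nonclassical hs hp
  have hsq : ∀ m : ℤ, m ≠ 0 → 1 - (s ^ 2) ^ m ≠ 0 := fun m hm => by
    have e : (s ^ 2) ^ m = s ^ (2 * m) := by rw [zpow_mul, zpow_ofNat]
    rw [sub_ne_zero, e, ne_comm]
    exact hs.zpow_ne_one _ (by omega)
  have key : ∀ j : ℕ, 1 ≤ j → j ≤ N → (Complex.I * ε / (1 - (s ^ 2) ^ (-2 * (N : ℤ) + 2 * j - 1))
        * (-s ^ 2 * ((1 - (s ^ 2) ^ (j : ℤ)) * (1 - (s ^ 2) ^ (-2 * (N : ℤ) - 2 + j)) /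
          (s ^ 2 - (s ^ 2)⁻¹)) * nonclassicalFactor (s ^ 2) s A₃ N ε j) ≠ 0 ↔
      nonclassicalFactor (s ^ 2) s A₃ N ε j ≠ 0) := by
    intro j hj hjN
    have h1 := left_ne_zero_of_mul (L.up_ne_zero j hjN)
    rw [mul_ne_zero_iff, and_iff_right h1, mul_ne_zero_iff, and_iff_right]
    exact mul_ne_zero (neg_ne_zero.2 (pow_ne_zero 2 h0)) (div_ne_zero (mul_ne_zero
      (hsq _ (by omega)) (hsq _ (by omega))) hs.sub_inv_ne_zero)
  refine (L.isIrreducible_iff hs hρ).trans ⟨fun h j hj hjN => ?_, fun h j hj hjN => ?_⟩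
  · obtain ⟨j, rfl⟩ := Int.eq_ofNat_of_zero_le (show 0 ≤ j by omega)
    exact (key j (by omega) (by omega)).1 (h j (by omega) (by omega))
  · exact (key j hj hjN).2 (h j (by omega) (by omega))

/-- The spectrum of `I₃` determines `ε`, since its parameters are `ε` times powers of `s`; the trace
of `I₁` then determines `a`. -/
theorem nonclassical_inequivalent (hs : Generic s)
    (hp : (ε, a) ∈ nonclassicalParams (s ^ 2) s A₃ N)
    (hp' : (ε', a') ∈ nonclassicalParams (s ^ 2) s A₃ N) {ρ ρ' : CoordRep s A₃ N}
    (hρ : HasMatrices ρ (nonclassicalI₁ (s ^ 2) s A₃ N ε a) (nonclassicalI₂ (s ^ 2) s A₃ N ε a)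
      (nonclassicalI₃ (s ^ 2) s N ε))
    (hρ' : HasMatrices ρ' (nonclassicalI₁ (s ^ 2) s A₃ N ε' a')
      (nonclassicalI₂ (s ^ 2) s A₃ N ε' a') (nonclassicalI₃ (s ^ 2) s N ε'))
    (h : IsEquivRep ρ ρ') : (ε, a) = (ε', a') := by
  have L := ladderData_nonclassical hs hp
  have L' := ladderData_nonclassical hs hp'
  obtain ⟨l, -, hl⟩ := L.exists_spec_eq_spec L' hρ hρ' h (Nat.zero_le N)
  have hεε : ε = ε' := by
    refine spec_sign_zpow_eq (m := 1) (n := 2 * l + 1) hs hp.1 hp'.1 ?_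
    rw [pow_zero, mul_one] at hl
    rw [zpow_one, hl, mul_assoc, ← pow_mul, ← pow_succ']
    norm_cast
  subst hεε
  rw [mul_right_cancel₀ (L.up_ne_zero N le_rfl) (h.trace_eq hρ hρ')]

/-- An irreducible representation with an eigenvalue of parameter `±s` is non-classical. -/
theorem exists_nonclassicalParams (hs : Generic s) {V : Type*} [AddCommGroup V] [Module ℂ V]
    {σ : AW s 0 0 A₃ →ₐ[ℂ] Module.End ℂ V} (hN : Module.finrank ℂ V = N + 1)
    (hirr : IsIrreducible σ) (hav : AvoidsEigenvalues (s ^ 2) σ)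
    (hloop : ¬ AvoidsLoop s (σ (gen 2))) :
    ∃ p ∈ nonclassicalParams (s ^ 2) s A₃ N, ∀ ρ : CoordRep s A₃ N,
      HasMatrices ρ (nonclassicalI₁ (s ^ 2) s A₃ N p.1 p.2)
        (nonclassicalI₂ (s ^ 2) s A₃ N p.1 p.2) (nonclassicalI₃ (s ^ 2) s N p.1) →
      IsEquivRep σ ρ := by
  have h0 := hs.ne_zero
  have : FiniteDimensional ℂ V := FiniteDimensional.of_finrank_pos (by omega)
  have hrel := relationsAt_rep σ
  rw [AvoidsLoop] at hloop
  push Not at hloop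
  obtain ⟨v, y, hy, hv, hv0⟩ := hloop
  obtain ⟨ε, hε, rfl⟩ : ∃ ε : ℂ, (ε = 1 ∨ ε = -1) ∧ y = ε * s := by
    rcases sq_eq_sq_iff_eq_or_eq_neg.1 hy with rfl | rfl
    · exact ⟨1, Or.inl rfl, (one_mul _).symm⟩
    · exact ⟨-1, Or.inr rfl, by ring⟩
  have hε2 : ε ^ 2 = 1 := by rcases hε with rfl | rfl <;> norm_num
  obtain ⟨t, u, hu0, hu⟩ := exists_isBottom_of_loop hs hrel hv0 hy hv
  have hres := nonResonant_of_loop (X₁ := σ (gen 0)) (X₂ := σ (gen 1)) hs hy u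
  obtain ⟨-, -, ht, -⟩ := climb_irreducible hs hrel hN ((isIrreducible_iff σ).1 hirr).2
    ((avoidsEigenvalues_iff σ).1 hav) hu hu0 hres
  -- The witness `a = -i ε q t` solves `t = i ε q⁻¹ a`.
  have ht' : t * (-Complex.I * ε * s ^ 2) * (Complex.I * ε * (s ^ 2)⁻¹) = t := by
    field_simp
    linear_combination -t * ε ^ 2 * Complex.I_sq + t * hε2
  have hp : (ε, t * (-Complex.I * ε * s ^ 2)) ∈ nonclassicalParams (s ^ 2) s A₃ N := by
    refine ⟨hε, ?_⟩
    rw [potential_sub_loop N hs hε] at ht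
    rw [mul_pow, ht, mul_pow, mul_pow, neg_sq, Complex.I_sq, hε2]
    field_simp
  refine ⟨_, hp, fun ρ hρ => ?_⟩
  have L := ladderData_nonclassical hs hp
  rw [ht'] at L
  exact L.isEquivRep hs hρ hN hirr hav hu0 hu hres

end Nonclassical

/-! ### The classical representation and the excluded values. -/

section Classical

variable {s A₃ x : ℂ} {N : ℕ}

/-- Regularity of the classical parameter when `A₃` is not an excluded value. -/
theorem LadderEquation.sq_ne_zpow {w : ℂ} (hs : Generic s) (hw : LadderEquation s A₃ N w)
    (hex : ∀ (k : ℤ) (ε : ℂ), -1 ≤ k → k ≤ 2 * N + 1 → (ε = 1 ∨ ε = -1) →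
      ¬ IsExcluded (s ^ 2) s A₃ N k ε) (m : ℤ) (hm : -(N + 1) ≤ m) (hm' : m ≤ N + 1) :
    w ^ 2 ≠ s ^ (2 * m) := by
  intro e
  rw [mul_comm, zpow_mul, zpow_ofNat] at e
  have : ∃ ε : ℂ, (ε = 1 ∨ ε = -1) ∧ w = ε * s ^ m := by
    rcases sq_eq_sq_iff_eq_or_eq_neg.1 e with e | e
    · exact ⟨1, Or.inl rfl, by rw [e, one_mul]⟩
    · exact ⟨-1, Or.inr rfl, by rw [e]; ring⟩
  obtain ⟨ε, hε, rfl⟩ := this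
  refine hex (m + N) ε (by omega) (by omega) hε ((isExcluded_iff hs hε).2 ?_)
  rwa [add_sub_cancel_right]

/-- The two ends of the classical ladder would both have parameters `±s` to odd powers. Within the
range allowed by `hreg`, the bottom end forces `w²` to be a positive power of `q` and the top end a
negative one. -/
theorem classical_inequivalent {ε a : ℂ} (hs : Generic s)
    (hx : IsClassicalParam (s ^ 2) s A₃ N x)
    (hreg : ∀ m : ℤ, -(N + 1) ≤ m → m ≤ N + 1 → (-Complex.I * x * (s ^ N)⁻¹) ^ 2 ≠ s ^ (2 * m))
    (hp : (ε, a) ∈ nonclassicalParams (s ^ 2) s A₃ N) {ρ ρ' : CoordRep s A₃ N}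
    (hρ : HasMatrices ρ (classicalI₁ (s ^ 2) s N x) (classicalI₂ (s ^ 2) N x)
      (classicalI₃ (s ^ 2) N x))
    (hρ' : HasMatrices ρ' (nonclassicalI₁ (s ^ 2) s A₃ N ε a)
      (nonclassicalI₂ (s ^ 2) s A₃ N ε a) (nonclassicalI₃ (s ^ 2) s N ε)) :
    ¬ IsEquivRep ρ ρ' := by
  intro h
  have h0 := hs.ne_zero
  have L := ladderData_classical hs hx hreg
  have L' := ladderData_nonclassical hs hp
  have hε2 : ε ^ 2 = 1 := by rcases hp.1 with h | h <;> simp only at h <;> rw [h] <;> norm_num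
  set w := -Complex.I * x * (s ^ N)⁻¹ with hw
  have hz : -Complex.I * x * ((s ^ 2) ^ N)⁻¹ = w * s ^ (-N : ℤ) := by
    rw [hw, zpow_neg, zpow_natCast, pow_right_comm]
    field_simp
  have hw0 : w ≠ 0 := fun e => L.param_ne_zero (by rw [hz, e, zero_mul])
  -- the squares of the spectral parameters at the two ends of the ladder
  have key : ∀ i ≤ N, ∃ l ≤ N, w ^ 2 = s ^ (2 * (N - 2 * i + (2 * l + 1)) : ℤ) ∨
      w ^ 2 = s ^ (2 * (N - 2 * i - (2 * l + 1)) : ℤ) := by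
    intro i hi
    obtain ⟨l, hl, e⟩ := L.exists_spec_eq_spec L' hρ hρ' h hi
    have e1 : -Complex.I * x * ((s ^ 2) ^ N)⁻¹ * (s ^ 2) ^ i = w * s ^ (2 * i - N : ℤ) := by
      rw [hz, mul_assoc, ← pow_mul, ← zpow_natCast, ← zpow_add₀ h0]
      congr 2
      push_cast
      ring
    have e2 : ε * s * (s ^ 2) ^ l = ε * s ^ (2 * l + 1 : ℤ) := by
      rw [mul_assoc, ← pow_mul, ← pow_succ']
      norm_cast
    have hε0 : ε ≠ 0 := fun h => by norm_num [h] at hε2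
    rw [e1, e2] at e
    have hsq : ∀ m : ℤ, (s ^ m) ^ 2 = s ^ (2 * m) := fun m => by
      rw [mul_comm, zpow_mul, zpow_ofNat]
    have solve : ∀ m k k' : ℤ, w ^ 2 * s ^ m = s ^ k → k - m = k' → w ^ 2 = s ^ k' := by
      rintro m k _ e rfl
      rw [zpow_sub₀ h0, eq_div_iff (zpow_ne_zero _ h0), e]
    refine ⟨l, hl, ?_⟩
    rcases (spec_eq_spec_iff hs (mul_ne_zero hw0 (zpow_ne_zero _ h0))
      (mul_ne_zero hε0 (zpow_ne_zero _ h0))).1 e with e | e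
    · left
      have e := congrArg (· ^ 2) e
      simp only [mul_pow, hsq, hε2, one_mul] at e
      exact solve _ _ _ e (by ring)
    · right
      have e := congrArg (· ^ 2) e
      simp only [mul_pow, hsq, hε2, one_mul, one_pow] at e
      have e := eq_inv_of_mul_eq_one_left e
      rw [← zpow_neg] at e
      exact solve _ _ _ e (by ring)
  obtain ⟨l, hl, h1⟩ := key 0 (Nat.zero_le N)
  obtain ⟨l', hl', h2⟩ := key N le_rfl
  have h1 := h1.resolve_right (hreg _ (by omega) (by omega))
  have h2 := h2.resolve_left (hreg _ (by omega) (by omega))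
  have := hs.zpow_injective (h1.symm.trans h2)
  omega

end Classical

/-- The classical representation when `A₃` is not an excluded value; it is the only irreducible
representation without eigenvalues of parameter `±s`. -/
theorem exists_classical {s A₃ x : ℂ} {N : ℕ} (hs : Generic s)
    (hx : IsClassicalParam (s ^ 2) s A₃ N x)
    (hex : ∀ (k : ℤ) (ε : ℂ), -1 ≤ k → k ≤ 2 * N + 1 → (ε = 1 ∨ ε = -1) →
      ¬ IsExcluded (s ^ 2) s A₃ N k ε) :
    ∃ cl : CoordRep s A₃ N,
      HasMatrices cl (classicalI₁ (s ^ 2) s N x) (classicalI₂ (s ^ 2) N x)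
        (classicalI₃ (s ^ 2) N x) ∧
      AvoidsEigenvalues (s ^ 2) cl ∧ IsIrreducible cl ∧
      ∀ (V : Type*) [AddCommGroup V] [Module ℂ V] (σ : AW s 0 0 A₃ →ₐ[ℂ] Module.End ℂ V),
        Module.finrank ℂ V = N + 1 → IsIrreducible σ → AvoidsEigenvalues (s ^ 2) σ →
        AvoidsLoop s (σ (gen 2)) → IsEquivRep σ cl := by
  have h0 := hs.ne_zero
  have hw := ladderEquation_classical hs hx
  have hreg := hw.sq_ne_zpow hs hex
  have L := ladderData_classical hs hx hreg
  obtain ⟨cl, hcl⟩ := L.exists_coordRep hs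
  refine ⟨cl, hcl, L.avoidsEigenvalues hs hcl,
    (L.isIrreducible_iff hs hcl).2 (classical_down_ne_zero hs hx hreg), ?_⟩
  intro V _ _ σ hN hirr hav hloop
  have hrel := relationsAt_rep σ
  have hav' := (avoidsEigenvalues_iff σ).1 hav
  obtain ⟨-, -, -, H⟩ := exists_isBottom_of_ladderEquation hs hrel hN
    ((isIrreducible_iff σ).1 hirr).2 hav' hloop
  obtain ⟨u, hu0, hu⟩ := H _ L.param_ne_zero (by
    convert hw using 1
    rw [pow_right_comm]
    field_simp)
  exact L.isEquivRep hs hcl hN hirr hav hu0 hu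
    (nonResonant_of_avoids hs hrel hav' hloop hu.param_ne_zero hu.eigen)

/-- The number of non-classical parameters for an excluded value. -/
theorem ncard_nonclassicalParams_of_isExcluded {s A₃ ε : ℂ} {N : ℕ} {k : ℤ} (hs : Generic s)
    (hε : ε = 1 ∨ ε = -1) (h : IsExcluded (s ^ 2) s A₃ N k ε) :
    (nonclassicalParams (s ^ 2) s A₃ N).ncard = if k = 2 * N + 1 ∨ k = -1 then 3 else 4 := by
  have h0 := hs.ne_zero
  rw [ncard_nonclassicalParams A₃ N hs]
  refine if_congr ⟨fun h' => ?_, fun hk => ?_⟩ rfl rfl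
  · have : ∃ ε' : ℂ, (ε' = 1 ∨ ε' = -1) ∧ loopSq s A₃ N ε' = 0 :=
      h'.elim (fun h => ⟨1, Or.inl rfl, h⟩) fun h => ⟨-1, Or.inr rfl, h⟩
    obtain ⟨ε', hε', h'⟩ := this
    rw [loopSq_eq_zero_iff hs (Or.inl rfl), isExcluded_iff hs hε'] at h'
    rw [isExcluded_iff hs hε] at h
    have hne : ∀ {ε : ℂ}, ε = 1 ∨ ε = -1 → ε ≠ 0 := by
      rintro _ (rfl | rfl) <;> norm_num
    -- Both indices solve the same equation for `w`, so `k` equals `2N + 1` or its reflection `-1`.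
    rcases h.eq_or hs (mul_ne_zero (hne hε) (zpow_ne_zero _ h0))
      (mul_ne_zero (hne hε') (zpow_ne_zero _ h0)) h' with e | e
    · have : k - N = 2 * N + 1 - N := by
        refine hs.zpow_eq_or_eq_neg ?_
        rcases hε with rfl | rfl <;> rcases hε' with rfl | rfl
        · exact Or.inl (by linear_combination e)
        · exact Or.inr (by linear_combination e)
        · exact Or.inr (by linear_combination -e)
        · exact Or.inl (by linear_combination -e)
      omega
    · have : k - N + (2 * N + 1 - N) = 0 := by
        refine hs.zpow_eq_or_eq_neg ?_
        rw [zpow_add₀ h0, zpow_zero]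
        rcases hε with rfl | rfl <;> rcases hε' with rfl | rfl
        · exact Or.inl (by linear_combination e)
        · exact Or.inr (by linear_combination -e)
        · exact Or.inr (by linear_combination -e)
        · exact Or.inl (by linear_combination e)
      omega
  · have := (loopSq_eq_zero_iff hs hk).2 h
    rcases hε with rfl | rfl
    · exact Or.inl this
    · exact Or.inr this

end AskeyWilson

end

/-! ### Assembly of the classification. -/

theorem theorem5 (q s A₃ : ℂ) (hq₀ : q ≠ 0) (hq : ∀ n : ℕ, 0 < n → q ^ n ≠ 1)
    (hs : s ^ 2 = q) (N : ℕ) :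
    ∃ ncl : AskeyWilson.nonclassicalParams q s A₃ N → AskeyWilson.CoordRep s A₃ N,
      -- the non-classical representations: formulas, inequivalence, irreducibility
      (∀ p, AskeyWilson.HasMatrices (ncl p)
        (AskeyWilson.nonclassicalI₁ q s A₃ N p.1.1 p.1.2)
        (AskeyWilson.nonclassicalI₂ q s A₃ N p.1.1 p.1.2)
        (AskeyWilson.nonclassicalI₃ q s N p.1.1)) ∧
      (∀ p p', p ≠ p' → ¬ AskeyWilson.IsEquivRep (ncl p) (ncl p')) ∧
      (∀ p, AskeyWilson.AvoidsEigenvalues q (ncl p)) ∧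
      (∀ p, AskeyWilson.IsIrreducible (ncl p) ↔
        ∀ j : ℤ, 1 ≤ j → j ≤ N → AskeyWilson.nonclassicalFactor q s A₃ N p.1.1 j ≠ 0) ∧
      -- `A₃` avoids all excluded values: five representations
      ((∀ (k : ℤ) (ε : ℂ), -1 ≤ k → k ≤ 2 * N + 1 → (ε = 1 ∨ ε = -1) →
          ¬ AskeyWilson.IsExcluded q s A₃ N k ε) →
        (AskeyWilson.nonclassicalParams q s A₃ N).ncard = 4 ∧
        (∃ x, AskeyWilson.IsClassicalParam q s A₃ N x) ∧
        ∀ x, AskeyWilson.IsClassicalParam q s A₃ N x →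
          ∃ cl : AskeyWilson.CoordRep s A₃ N,
            AskeyWilson.HasMatrices cl (AskeyWilson.classicalI₁ q s N x)
              (AskeyWilson.classicalI₂ q N x) (AskeyWilson.classicalI₃ q N x) ∧
            (∀ p, ¬ AskeyWilson.IsEquivRep cl (ncl p)) ∧
            AskeyWilson.AvoidsEigenvalues q cl ∧
            AskeyWilson.IsIrreducible cl ∧
            ∀ (V : Type*) [AddCommGroup V] [Module ℂ V]
              (ρ : AskeyWilson.AW s 0 0 A₃ →ₐ[ℂ] Module.End ℂ V),
              Module.finrank ℂ V = N + 1 → AskeyWilson.IsIrreducible ρ →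
              AskeyWilson.AvoidsEigenvalues q ρ →
              AskeyWilson.IsEquivRep ρ cl ∨ ∃ p, AskeyWilson.IsEquivRep ρ (ncl p)) ∧
      -- `A₃` is an excluded value: four representations, or three
      (∀ (k : ℤ) (ε : ℂ), -1 ≤ k → k ≤ 2 * N + 1 → (ε = 1 ∨ ε = -1) →
          AskeyWilson.IsExcluded q s A₃ N k ε →
        (AskeyWilson.nonclassicalParams q s A₃ N).ncard
            = (if k = 2 * N + 1 ∨ k = -1 then 3 else 4) ∧
        ∀ (V : Type*) [AddCommGroup V] [Module ℂ V]
          (ρ : AskeyWilson.AW s 0 0 A₃ →ₐ[ℂ] Module.End ℂ V),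
          Module.finrank ℂ V = N + 1 → AskeyWilson.IsIrreducible ρ →
          AskeyWilson.AvoidsEigenvalues q ρ →
          ∃ p, AskeyWilson.IsEquivRep ρ (ncl p)) := by
  subst hs
  have hs := AskeyWilson.generic_of_sq hq₀ hq
  have hncl : ∀ p : AskeyWilson.nonclassicalParams (s ^ 2) s A₃ N,
      ∃ ρ : AskeyWilson.CoordRep s A₃ N, AskeyWilson.HasMatrices ρ
        (AskeyWilson.nonclassicalI₁ (s ^ 2) s A₃ N p.1.1 p.1.2)
        (AskeyWilson.nonclassicalI₂ (s ^ 2) s A₃ N p.1.1 p.1.2)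
        (AskeyWilson.nonclassicalI₃ (s ^ 2) s N p.1.1) :=
    fun p => (AskeyWilson.ladderData_nonclassical hs p.2).exists_coordRep hs
  choose ncl hncl using hncl
  refine ⟨ncl, hncl, fun p p' hp h => hp (Subtype.ext
      (AskeyWilson.nonclassical_inequivalent hs p.2 p'.2 (hncl p) (hncl p') h)),
    fun p => (AskeyWilson.ladderData_nonclassical hs p.2).avoidsEigenvalues hs (hncl p),
    fun p => AskeyWilson.nonclassical_isIrreducible_iff hs p.2 (hncl p), fun hex => ⟨?_, ?_, ?_⟩,
    fun k ε hk hk' hε h => ⟨AskeyWilson.ncard_nonclassicalParams_of_isExcluded hs hε h, ?_⟩⟩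
  · rw [AskeyWilson.ncard_nonclassicalParams A₃ N hs, if_neg]
    rintro (h | h)
    · exact hex (-1) 1 le_rfl (by omega) (Or.inl rfl)
        ((AskeyWilson.loopSq_eq_zero_iff hs (Or.inr rfl)).1 h)
    · exact hex (-1) (-1) le_rfl (by omega) (Or.inr rfl)
        ((AskeyWilson.loopSq_eq_zero_iff hs (Or.inr rfl)).1 h)
  · obtain ⟨w, hw0, hw⟩ := AskeyWilson.exists_ladderEquation A₃ N hs
    exact ⟨_, (AskeyWilson.isClassicalParam_iff hs hw0).2 hw⟩
  · intro x hx
    have hreg := (AskeyWilson.ladderEquation_classical hs hx).sq_ne_zpow hs hex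
    obtain ⟨cl, hcl, hav, hirr, hall⟩ := AskeyWilson.exists_classical hs hx hex
    refine ⟨cl, hcl, fun p => AskeyWilson.classical_inequivalent hs hx hreg p.2 hcl (hncl p), hav,
      hirr, fun V _ _ ρ hN hρ hρ' => ?_⟩
    -- A parameter `±s` in the spectrum of `I₃` separates the non-classical representations from the
    -- classical one.
    by_cases hloop : AskeyWilson.AvoidsLoop s (ρ (AskeyWilson.gen 2))
    · exact Or.inl (hall V ρ hN hρ hρ' hloop)
    · obtain ⟨p, hp, h⟩ := AskeyWilson.exists_nonclassicalParams hs hN hρ hρ' hloop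
      exact Or.inr ⟨⟨p, hp⟩, h _ (hncl ⟨p, hp⟩)⟩
  · intro V _ _ ρ hN hρ hρ'
    have hε2 : ε ^ 2 = 1 := by rcases hε with rfl | rfl <;> norm_num
    have hloop := AskeyWilson.not_avoidsLoop_of_excluded hs (AskeyWilson.relationsAt_rep ρ) hN
      ((AskeyWilson.isIrreducible_iff ρ).1 hρ).2 ((AskeyWilson.avoidsEigenvalues_iff ρ).1 hρ') hε2
      hk hk' ((AskeyWilson.isExcluded_iff hs hε).1 h)
    obtain ⟨p, hp, h⟩ := AskeyWilson.exists_nonclassicalParams hs hN hρ hρ' hloop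
    exact ⟨⟨p, hp⟩, h _ (hncl ⟨p, hp⟩)⟩
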